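/- Let $A=(a_{ij})_{i,j\in I}$ be a generalized Cartan matrix of size $n=|I|\ge 2$, that is, an integral matrix with $a_{ii}=2$, $a_{ij}\le 0$ for $i\ne j$, and $a_{ij}=0\Rightarrow a_{ji}=0$. Let $(A,X,Y,(\alpha_i)_{i\in I},(\alpha_i^\vee)_{i\in I})$ be a Kac--Moody root datum: $X$ and $Y$ are free $\mathbb Z$-modules of finite rank, dual to each other under a perfect pairing $\langle\cdot,\cdot\rangle : Y\times X\to\mathbb Z$, the families $(\alpha_i)$ in $X$ and $(\alpha_i^\vee)$ in $Y$ are linearly independent, and $\langle\alpha_i^\vee,\alpha_j\rangle=a_{ij}$. Let $W$ be the group of automorphisms of $X$ generated by the simple reflections $r_i:x\mapsto x-\langle\alpha_i^\vee,x\rangle\alpha_i$, acting on $Y$ by the contragredient action. Let $\Phi=W\cdot\{\alpha_i\mid i\in I\}$ be the set of real roots, $\Phi_+=\Phi\cap\bigoplus_{i}\mathbb N\alpha_i$ and $\Phi_-=-\Phi_+$. For $\beta=w(\alpha_i)\in\Phi$ with $w\in W$, $i\in I$, put $\beta^\vee=w(\alpha_i^\vee)$ and $s_\beta=wr_iw^{-1}$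 (these depend only on $\beta$), and for $w\in W$ put $\mathrm{Inv}(w)=\{\gamma\in\Phi_+\mid w(\gamma)\in\Phi_-\}$. A root $\beta\in\Phi_+$ is called quantum if $\langle\beta^\vee,\gamma\rangle=1$ for every $\gamma\in\mathrm{Inv}(s_\beta)\setminus\{\beta\}$. Theorem. The set of quantum roots is finite, with at most $n^{n+5}$ elements. -/

import Mathlib

/-- A generalized Cartan matrix (Kac--Moody matrix) over the index set `I`. -/
structure IsGeneralizedCartanMatrix {I : Type*} (A : Matrix I I ℤ) : Prop where
  diag : ∀ i, A i i = 2
  nonpos : ∀ i j, i ≠ j → A i j ≤ 0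
  zero_symm : ∀ i j, A i j = 0 → A j i = 0

/-- A Kac--Moody root datum `(A, X, Y, (α i), (α i)^∨)`: the free `ℤ`-modules `X` and `Y` of
finite rank are in duality, and the simple roots (resp. simple coroots) are linearly independent
elements of `X` (resp. `Y`) with `⟨(α i)^∨, α j⟩ = A i j`. -/
structure KacMoodyRootDatum {I : Type*} [Fintype I] (A : Matrix I I ℤ) (X Y : Type*)
    [AddCommGroup X] [Module.Free ℤ X] [Module.Finite ℤ X]
    [AddCommGroup Y] [Module.Free ℤ Y] [Module.Finite ℤ Y] where
  isGCM : IsGeneralizedCartanMatrix A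
  pairing : Y →ₗ[ℤ] X →ₗ[ℤ] ℤ
  isPerfPair : pairing.IsPerfPair
  simpleRoot : I → X
  simpleCoroot : I → Y
  linearIndependent_simpleRoot : LinearIndependent ℤ simpleRoot
  linearIndependent_simpleCoroot : LinearIndependent ℤ simpleCoroot
  pairing_simple : ∀ i j, pairing (simpleCoroot i) (simpleRoot j) = A i j

namespace KacMoodyRootDatum

variable {I : Type*} [Fintype I] {A : Matrix I I ℤ} {X Y : Type*}
  [AddCommGroup X] [Module.Free ℤ X] [Module.Finite ℤ X]
  [AddCommGroup Y] [Module.Free ℤ Y] [Module.Finite ℤ Y]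

attribute [instance] KacMoodyRootDatum.isPerfPair

theorem pairing_simple_self (D : KacMoodyRootDatum A X Y) (i : I) :
    D.pairing (D.simpleCoroot i) (D.simpleRoot i) = 2 := by
  rw [D.pairing_simple, D.isGCM.diag]

/-- The simple reflection `r i : x ↦ x - ⟨(α i)^∨, x⟩ • α i` of `X`. -/
def simpleReflection (D : KacMoodyRootDatum A X Y) (i : I) : X ≃ₗ[ℤ] X :=
  Module.reflection (D.pairing_simple_self i)

/-- The vectorial Weyl group, generated by the simple reflections. -/
def weylGroup (D : KacMoodyRootDatum A X Y) : Subgroup (X ≃ₗ[ℤ] X) :=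
  Subgroup.closure (Set.range D.simpleReflection)

/-- The contragredient action on `Y` of an automorphism `w` of `X`; it is characterized by
`⟨w y, w x⟩ = ⟨y, x⟩`. -/
noncomputable def contragredient (D : KacMoodyRootDatum A X Y) (w : X ≃ₗ[ℤ] X) : Y ≃ₗ[ℤ] Y :=
  (D.pairing.toPerfPair.trans w.symm.dualMap).trans D.pairing.toPerfPair.symm

theorem pairing_contragredient (D : KacMoodyRootDatum A X Y) (w : X ≃ₗ[ℤ] X) (y : Y) (x : X) :
    D.pairing (D.contragredient w y) x = D.pairing y (w.symm x) := by
  simp [contragredient]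

theorem contragredient_simpleReflection (D : KacMoodyRootDatum A X Y) (i : I) (y : Y) :
    D.contragredient (D.simpleReflection i) y
      = y - D.pairing y (D.simpleRoot i) • D.simpleCoroot i := by
  apply D.pairing.toPerfPair.injective
  ext x
  simp [pairing_contragredient, simpleReflection, Module.reflection_apply, mul_comm]

/-- The real roots: the Weyl group orbit of the simple roots. -/
def realRoots (D : KacMoodyRootDatum A X Y) : Set X :=
  {β | ∃ w ∈ D.weylGroup, ∃ i, w (D.simpleRoot i) = β}

/-- The positive real roots: the real roots in `⨁ i, ℕ • α i`. -/
def posRoots (D : KacMoodyRootDatum A X Y) : Set X :=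
  {β | β ∈ D.realRoots ∧ ∃ c : I → ℕ, β = ∑ i, c i • D.simpleRoot i}

/-- The negative real roots. -/
def negRoots (D : KacMoodyRootDatum A X Y) : Set X :=
  {β | -β ∈ D.posRoots}

/-- The inversion set of `w`: the positive real roots that `w` sends to negative ones. -/
def inversions (D : KacMoodyRootDatum A X Y) (w : X ≃ₗ[ℤ] X) : Set X :=
  {γ | γ ∈ D.posRoots ∧ w γ ∈ D.negRoots}

/-- A positive real root `β` is quantum if `⟨β^∨, γ⟩ = 1` for all `γ ≠ β` in the inversion set of
the reflection `s_β`. Here, for `β = w (α i)` with `w` in the Weyl group, `β^∨ = w ((α i)^∨)` and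
`s_β = w * r i * w⁻¹`; neither depends on the way `β` is written as `w (α i)`. -/
def IsQuantum (D : KacMoodyRootDatum A X Y) (β : X) : Prop :=
  β ∈ D.posRoots ∧ ∀ w ∈ D.weylGroup, ∀ i, w (D.simpleRoot i) = β →
    ∀ γ ∈ D.inversions (w * D.simpleReflection i * w⁻¹), γ ≠ β →
      D.pairing (D.contragredient w (D.simpleCoroot i)) γ = 1

/-- The set of quantum roots. -/
def quantumRoots (D : KacMoodyRootDatum A X Y) : Set X :=
  {β | D.IsQuantum β}

end KacMoodyRootDatum

/-- Every generalized Cartan matrix belongs to some Kac--Moody root datum. -/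
theorem nonempty_kacMoodyRootDatum {I : Type*} [Fintype I] {A : Matrix I I ℤ}
    (hA : IsGeneralizedCartanMatrix A) :
    Nonempty (KacMoodyRootDatum A (I ⊕ I → ℤ) (Module.Dual ℤ (I ⊕ I → ℤ))) := by
  classical
  refine ⟨⟨hA, .id, inferInstance, fun j => Sum.elim (fun i => A i j) (Pi.single j 1),
    fun i => LinearMap.proj (Sum.inl i), ?_, ?_, fun i j => by simp⟩⟩
  · rw [Fintype.linearIndependent_iff]
    intro g hg i
    simpa [Finset.sum_apply, Pi.single_apply] using congrFun hg (Sum.inr i)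
  · rw [Fintype.linearIndependent_iff]
    intro g hg i
    simpa [Pi.single_apply] using LinearMap.congr_fun hg (Pi.single (Sum.inl i) 1)

/-! Write the coroot of a quantum root β as ∑ c_i α_i^∨. If β is not simple, ⟨β^∨, β⟩ = 2 forces
⟨β^∨, α_i⟩ > 0 for some i. Then s_β(α_i) is negative, so the pairing is 1, and r_i β is again
quantum, with coroot β^∨ - α_i^∨ (`IsQuantumPair.exists_reflection`). Thus c grows from a basis
vector one unit at a time, the coordinate j only when ∑_{i≠j} c_i |a_ij| = 2 c_j + 1
(`IsQuantumPair.growth`). As a coroot determines its root, it is enough to show c_i ≤ max(6, n)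
(`Growth.le_max`).

A vertex entering the support has a single neighbour there, of multiplicity 1; so the neighbourhood
of a vertex of multiplicity at least 2 is frozen, and such a vertex lies in a tripod: a centre b and
three paths issued from it (`Growth.exists_tripod`). Put m = c_b and list the successive differences
of c along each arm, closing with the last multiplicity, so that each list sums to m. A step on an
arm swaps two adjacent entries or inserts a 0; a step at the centre requires the heads to sum to m -
1 and adds 1 to each. Hence the squares of all entries always sum to m² + 2. When some arm has all
its entries at most 1, m is at most the length of its list, hence at most n. This property persists
except through one case of equality in the energy estimate, which leads to m = 6; from there a
central step needs a zero head, which restores the property.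

The signs of roots come from Tits' argument: g(α_i) is positive exactly when g is not longer than g
r_i. It is carried out for any `ReflectionRep`, so that it covers roots and coroots with the same
group. -/

/-! ### Difference sequences along the arms. -/

/-- The elementary moves on the sequence of successive differences along an arm. -/
inductive ArmMove : List ℕ → List ℕ → Prop
  | refl (x) : ArmMove x x
  | swap (a x) : ArmMove ((a + 1) :: a :: x) (a :: (a + 1) :: x)
  | grow : ArmMove [1, 1] [0, 1, 1]
  | cons (a) {x y} : ArmMove x y → ArmMove (a :: x) (a :: y)

namespace ArmMove

/-- A move only permutes entries or inserts a zero; this and the next lemmas record what survives.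
-/
theorem sum_eq {x y : List ℕ} (h : ArmMove x y) : y.sum = x.sum := by
  induction h with
  | refl => rfl
  | swap a x => simp; omega
  | grow => rfl
  | cons a _ ih => simp [ih]

theorem sum_sq_eq {x y : List ℕ} (h : ArmMove x y) :
    (y.map (· ^ 2)).sum = (x.map (· ^ 2)).sum := by
  induction h with
  | refl => rfl
  | swap a x => simp; omega
  | grow => rfl
  | cons a _ ih => simp [ih]

theorem mem_of_mem {x y : List ℕ} (h : ArmMove x y) {a : ℕ} (ha : a ∈ x) : a ∈ y := by
  induction h with
  | refl => exact ha
  | swap => simp at ha ⊢; tauto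
  | grow => simp at ha ⊢; tauto
  | cons b _ ih => simp at ha ⊢; tauto

theorem eq_zero_or_mem {x y : List ℕ} (h : ArmMove x y) {a : ℕ} (ha : a ∈ y) : a = 0 ∨ a ∈ x := by
  induction h with
  | refl => exact .inr ha
  | swap => simp at ha ⊢; tauto
  | grow => simp at ha ⊢; tauto
  | cons b _ ih => simp at ha ⊢; tauto

/-- The slack of 1 in the bound is exactly what `swap` needs, since it puts `a + 1` after `a`. -/
theorem pairwise {x y : List ℕ} (h : ArmMove x y) (hx : x.Pairwise fun a b => b ≤ a + 1) :
    y.Pairwise fun a b => b ≤ a + 1 := by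
  induction h with
  | refl => exact hx
  | swap a x =>
    simp only [List.pairwise_cons, List.mem_cons] at hx ⊢
    refine ⟨?_, ?_, hx.2.2⟩
    · rintro b (rfl | hb)
      · rfl
      · exact hx.2.1 b hb
    · exact fun b hb => hx.1 b (.inr hb)
  | grow => simp
  | cons a h ih =>
    simp only [List.pairwise_cons] at hx ⊢
    refine ⟨fun b hb => ?_, ih hx.2⟩
    rcases h.eq_zero_or_mem hb with rfl | hb
    · omega
    · exact hx.1 b hb

end ArmMove

/-- If the entries of a list are bounded by `b`, then the sum of its squares is at most `b` times
its sum. -/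
theorem List.sum_sq_le_mul_sum {b : ℕ} {r : List ℕ} (hr : ∀ y ∈ r, y ≤ b) :
    (r.map (· ^ 2)).sum ≤ b * r.sum := by
  induction r with
  | nil => simp
  | cons y r ih =>
    simp only [List.forall_mem_cons] at hr
    have := ih hr.2
    simp only [List.map_cons, List.sum_cons, mul_add]
    nlinarith [hr.1]

theorem List.eq_zero_or_eq_of_sum_sq_eq {b : ℕ} {r : List ℕ} (hr : ∀ y ∈ r, y ≤ b)
    (h : (r.map (· ^ 2)).sum = b * r.sum) : ∀ y ∈ r, y = 0 ∨ y = b := by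
  induction r with
  | nil => simp
  | cons y r ih =>
    simp only [List.forall_mem_cons] at hr ⊢
    have h1 := List.sum_sq_le_mul_sum hr.2
    simp only [List.map_cons, List.sum_cons, mul_add] at h
    have h2 : y ^ 2 ≤ b * y := by nlinarith [hr.1]
    refine ⟨?_, ih hr.2 (by omega)⟩
    have h3 : y * y = b * y := by nlinarith
    rcases Nat.eq_zero_or_pos y with h0 | h0
    · exact .inl h0
    · exact .inr (Nat.eq_of_mul_eq_mul_right h0 h3)

theorem List.sum_sq_eq_sum {r : List ℕ} (hr : ∀ y ∈ r, y ≤ 1) :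
    (r.map (· ^ 2)).sum = r.sum := by
  congr 1
  conv_rhs => rw [← List.map_id r]
  refine List.map_congr_left fun y hy => ?_
  have := hr y hy
  interval_cases y <;> rfl

theorem List.dvd_sum_of_eq_zero_or_eq {b : ℕ} {r : List ℕ} (hr : ∀ y ∈ r, y = 0 ∨ y = b) :
    b ∣ r.sum := by
  refine List.dvd_sum fun y hy => ?_
  rcases hr y hy with rfl | rfl <;> simp

/-- Each number divides the other plus one, so they differ by at most 1. Equality would give a
divisor of 1, and a difference of 1 makes the smaller one divide 2. -/
theorem eq_two_or_eq_three_of_dvd {b c : ℕ} (hb : 2 ≤ b) (hc : 2 ≤ c) (h1 : b ∣ b + c + 1)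
    (h2 : c ∣ b + c + 1) : (b = 2 ∧ c = 3) ∨ (b = 3 ∧ c = 2) := by
  have h1' : b ∣ c + 1 := by rwa [add_assoc, Nat.dvd_add_right dvd_rfl] at h1
  have h2' : c ∣ b + 1 := by
    rwa [show b + c + 1 = c + (b + 1) by ring, Nat.dvd_add_right dvd_rfl] at h2
  have l1 := Nat.le_of_dvd (by omega) h1'
  have l2 := Nat.le_of_dvd (by omega) h2'
  have : c = b + 1 ∨ c = b ∨ b = c + 1 := by omega
  rcases this with rfl | rfl | rfl
  · have : b ∣ 2 := by rwa [add_assoc, Nat.dvd_add_right dvd_rfl] at h1'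
    have := Nat.le_of_dvd (by omega) this
    omega
  · have : c ∣ 1 := by rwa [Nat.dvd_add_right dvd_rfl] at h1'
    have := Nat.le_of_dvd (by omega) this
    omega
  · have : c ∣ 2 := by rwa [add_assoc, Nat.dvd_add_right dvd_rfl] at h2'
    have := Nat.le_of_dvd (by omega) this
    omega

/-- The central step in which no arm starts with `0` while the third one has all its entries at
most `1`. -/
theorem heads_of_central_step {m a₁ a₂ a₃ : ℕ} {r₁ r₂ r₃ : List ℕ}
    (s₁ : (a₁ :: r₁).sum = m) (s₂ : (a₂ :: r₂).sum = m) (s₃ : (a₃ :: r₃).sum = m)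
    (p₁ : (a₁ :: r₁).Pairwise fun a b => b ≤ a + 1)
    (p₂ : (a₂ :: r₂).Pairwise fun a b => b ≤ a + 1)
    (energy : ((a₁ :: r₁).map (· ^ 2)).sum + ((a₂ :: r₂).map (· ^ 2)).sum
      + ((a₃ :: r₃).map (· ^ 2)).sum = m ^ 2 + 2)
    (h₃ : ∀ y ∈ a₃ :: r₃, y ≤ 1) (ha : a₁ + a₂ + a₃ + 1 = m)
    (ha₁ : a₁ ≠ 0) (ha₂ : a₂ ≠ 0) (ha₃ : a₃ ≠ 0) :
    m = 5 ∧ a₁ + a₂ = 3 ∧ a₃ = 1 ∧ (∀ y ∈ r₁, y = 0 ∨ y = a₁ + 1) ∧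
      (∀ y ∈ r₂, y = 0 ∨ y = a₂ + 1) := by
  have e₃ : a₃ = 1 := le_antisymm (h₃ a₃ (by simp)) (by omega)
  rw [List.sum_sq_eq_sum h₃, s₃] at energy
  rw [List.pairwise_cons] at p₁ p₂
  have c₁ := List.sum_sq_le_mul_sum p₁.1
  have c₂ := List.sum_sq_le_mul_sum p₂.1
  simp only [List.map_cons, List.sum_cons] at energy s₁ s₂
  have hm : m = a₁ + a₂ + 2 := by omega
  have t₁ : r₁.sum = a₂ + 2 := by omega
  have t₂ : r₂.sum = a₁ + 2 := by omega
  rw [hm] at energy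
  rw [t₁] at c₁
  rw [t₂] at c₂
  -- The bounds `c₁` and `c₂` add up to exactly what `energy` leaves for the two tails, so both are
  -- equalities and every tail entry is 0 or maximal.
  have d₁ : (r₁.map (· ^ 2)).sum = (a₁ + 1) * (a₂ + 2) := by nlinarith
  have d₂ : (r₂.map (· ^ 2)).sum = (a₂ + 1) * (a₁ + 2) := by nlinarith
  have f₁ := List.eq_zero_or_eq_of_sum_sq_eq p₁.1 (by rw [d₁, t₁])
  have f₂ := List.eq_zero_or_eq_of_sum_sq_eq p₂.1 (by rw [d₂, t₂])
  have g₁ := List.dvd_sum_of_eq_zero_or_eq f₁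
  have g₂ := List.dvd_sum_of_eq_zero_or_eq f₂
  -- Here b + c + 1 = m + 1 is the sum of each list after the step, and the first two lists then
  -- consist of multiples of `a₁ + 1` and `a₂ + 1`.
  have := eq_two_or_eq_three_of_dvd (b := a₁ + 1) (c := a₂ + 1) (by omega) (by omega)
    (by rw [show a₁ + 1 + (a₂ + 1) + 1 = (a₁ + 1) + r₁.sum by omega]; exact (dvd_refl _).add g₁)
    (by rw [show a₁ + 1 + (a₂ + 1) + 1 = (a₂ + 1) + r₂.sum by omega]; exact (dvd_refl _).add g₂)
  exact ⟨by omega, by omega, e₃, f₁, f₂⟩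

/-- The invariants of the sequences of differences along the three arms issued from a vertex
with coefficient `m`. -/
structure ArmInvariants (m : ℕ) (x : Fin 3 → List ℕ) : Prop where
  sum_eq : ∀ i, (x i).sum = m
  pairwise : ∀ i, (x i).Pairwise fun a b => b ≤ a + 1
  energy : ∑ i, ((x i).map (· ^ 2)).sum = m ^ 2 + 2
  small : (∃ i, ∀ y ∈ x i, y ≤ 1) ∨ (m ≤ 6 ∧ ∃ e : Fin 3 → ℕ, m ≤ ∑ i, e i ∧
    ∀ i, (∃ y ∈ x i, 2 ≤ y) ∧ ∀ y ∈ x i, y = 0 ∨ e i ≤ y)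

namespace ArmInvariants

theorem move {m : ℕ} {x y : Fin 3 → List ℕ} (h : ArmInvariants m x)
    (hxy : ∀ i, ArmMove (x i) (y i)) : ArmInvariants m y where
  sum_eq i := by rw [(hxy i).sum_eq, h.sum_eq]
  pairwise i := (hxy i).pairwise (h.pairwise i)
  energy := by simp only [fun i => (hxy i).sum_sq_eq, h.energy]
  small := by
    rcases h.small with ⟨i, hi⟩ | ⟨hm, e, he, h⟩
    · refine .inl ⟨i, fun a ha => ?_⟩
      rcases (hxy i).eq_zero_or_mem ha with rfl | ha
      · omega
      · exact hi a ha
    · refine .inr ⟨hm, e, he, fun i => ⟨?_, fun a ha => ?_⟩⟩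
      · obtain ⟨a, ha, ha2⟩ := (h i).1
        exact ⟨a, (hxy i).mem_of_mem ha, ha2⟩
      · rcases (hxy i).eq_zero_or_mem ha with rfl | ha
        · exact .inl rfl
        · exact (h i).2 a ha

theorem initial : ArmInvariants 2 fun _ => [1, 1] where
  sum_eq _ := rfl
  pairwise _ := by simp
  energy := rfl
  small := .inl ⟨0, by simp⟩

/-- The sequences after the only central step in which no arm starts with `0`. -/
theorem exceptional {a₁ a₂ a₃ : ℕ} {r₁ r₂ r₃ : List ℕ} (i₁ i₂ i₃ : Fin 3)
    (hi : ∀ i, i = i₁ ∨ i = i₂ ∨ i = i₃) (h₁₂ : i₁ ≠ i₂) (h₁₃ : i₁ ≠ i₃) (h₂₃ : i₂ ≠ i₃)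
    {x : Fin 3 → List ℕ}
    (hx₁ : x i₁ = (a₁ + 1) :: r₁) (hx₂ : x i₂ = (a₂ + 1) :: r₂) (hx₃ : x i₃ = (a₃ + 1) :: r₃)
    (ha₁ : a₁ ≠ 0) (ha₂ : a₂ ≠ 0)
    (h : a₁ + a₂ = 3 ∧ a₃ = 1 ∧ (∀ y ∈ r₁, y = 0 ∨ y = a₁ + 1) ∧
      (∀ y ∈ r₂, y = 0 ∨ y = a₂ + 1)) :
    ∃ e : Fin 3 → ℕ, 6 ≤ ∑ i, e i ∧
      ∀ i, (∃ y ∈ x i, 2 ≤ y) ∧ ∀ y ∈ x i, y = 0 ∨ e i ≤ y := by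
  obtain ⟨h12, rfl, h₁, h₂⟩ := h
  -- On the first two arms all nonzero entries now equal the head; on the third they are at least 1.
  -- The total is (a₁ + 1) + (a₂ + 1) + 1 = 6.
  refine ⟨fun i => if i = i₁ then a₁ + 1 else if i = i₂ then a₂ + 1 else 1, ?_, fun i => ?_⟩
  · have : (Finset.univ : Finset (Fin 3)) = {i₁, i₂, i₃} := by
      ext i; simpa using hi i
    rw [this, Finset.sum_insert (by simp [h₁₂, h₁₃]), Finset.sum_insert (by simp [h₂₃]),
      Finset.sum_singleton]
    simp [h₁₂.symm, h₁₃.symm, h₂₃.symm]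
    omega
  · rcases hi i with rfl | rfl | rfl
    · rw [hx₁]
      refine ⟨⟨_, List.mem_cons_self, by omega⟩, ?_⟩
      simp only [List.forall_mem_cons, if_true]
      exact ⟨.inr le_rfl, fun y hy => (h₁ y hy).imp_right fun h => h.ge⟩
    · rw [hx₂]
      refine ⟨⟨_, List.mem_cons_self, by omega⟩, ?_⟩
      simp only [List.forall_mem_cons, if_true, h₁₂.symm, if_false]
      exact ⟨.inr le_rfl, fun y hy => (h₂ y hy).imp_right fun h => h.ge⟩
    · rw [hx₃]
      refine ⟨⟨_, List.mem_cons_self, by omega⟩, fun y _ => ?_⟩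
      simp only [h₁₃.symm, h₂₃.symm, if_false]
      omega

/-- The heads sum to m - 1, so the energy grows by 2(m - 1) + 3 = (m + 1)² - m². For `small`: a zero
head forces, by `pairwise`, all later entries of its arm to be at most 1, and the new head is 1.
Without zero heads, an arm with entries at most 1 forces the exceptional configuration with m = 5.
-/
theorem central_step {m : ℕ} {a : Fin 3 → ℕ} {r : Fin 3 → List ℕ}
    (h : ArmInvariants m fun i => a i :: r i) (ha : ∑ i, a i + 1 = m) :
    ArmInvariants (m + 1) fun i => (a i + 1) :: r i where
  sum_eq i := by have := h.sum_eq i; simp at this ⊢; omega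
  pairwise i := by
    have := h.pairwise i
    simp only [List.pairwise_cons] at this ⊢
    exact ⟨fun b hb => (this.1 b hb).trans (by omega), this.2⟩
  energy := by
    have := h.energy
    simp only [Fin.sum_univ_three, List.map_cons, List.sum_cons] at this ha ⊢
    nlinarith
  small := by
    by_cases h0 : ∃ i, a i = 0
    · obtain ⟨i, hi⟩ := h0
      have := h.pairwise i
      rw [List.pairwise_cons, hi] at this
      refine .inl ⟨i, ?_⟩
      simp only [List.forall_mem_cons, hi]
      exact ⟨by omega, this.1⟩
    · push Not at h0
      rcases h.small with ⟨i, hi⟩ | ⟨hm, e, he, hx⟩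
      · right
        have en := h.energy
        simp only [Fin.sum_univ_three] at en ha
        have key : ∀ i₁ i₂ i₃ : Fin 3, (∀ i, i = i₁ ∨ i = i₂ ∨ i = i₃) → i₁ ≠ i₂ → i₁ ≠ i₃ →
            i₂ ≠ i₃ → (∀ y ∈ a i₃ :: r i₃, y ≤ 1) → a i₁ + a i₂ + a i₃ + 1 = m →
            ((a i₁ :: r i₁).map (· ^ 2)).sum + ((a i₂ :: r i₂).map (· ^ 2)).sum
              + ((a i₃ :: r i₃).map (· ^ 2)).sum = m ^ 2 + 2 →
            m + 1 ≤ 6 ∧ ∃ e : Fin 3 → ℕ, m + 1 ≤ ∑ i, e i ∧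
              ∀ i, (∃ y ∈ (a i + 1) :: r i, 2 ≤ y) ∧ ∀ y ∈ (a i + 1) :: r i, y = 0 ∨ e i ≤ y := by
          intro i₁ i₂ i₃ hi h₁₂ h₁₃ h₂₃ h₃ ha en
          obtain ⟨hm, hh⟩ := heads_of_central_step (h.sum_eq i₁) (h.sum_eq i₂) (h.sum_eq i₃)
            (h.pairwise i₁) (h.pairwise i₂) en h₃ ha (h0 i₁) (h0 i₂) (h0 i₃)
          subst hm
          exact ⟨le_rfl, exceptional i₁ i₂ i₃ hi h₁₂ h₁₃ h₂₃ rfl rfl rfl (h0 i₁) (h0 i₂) hh⟩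
        fin_cases i
        · exact key 1 2 0 (by decide) (by decide) (by decide) (by decide) hi (by omega) (by omega)
        · exact key 0 2 1 (by decide) (by decide) (by decide) (by decide) hi (by omega) (by omega)
        · exact key 0 1 2 (by decide) (by decide) (by decide) (by decide) hi (by omega) (by omega)
      -- Nonzero heads are at least `e i`, so they sum to at least m, whereas a central step needs m
      -- - 1.
      · exfalso
        have : ∀ i, e i ≤ a i := fun i =>
          ((hx i).2 (a i) (by simp)).resolve_left (h0 i)
        have := Finset.sum_le_sum fun i (_ : i ∈ Finset.univ) => this i
        omega

theorem le_six_or_le_length {m : ℕ} {x : Fin 3 → List ℕ} (h : ArmInvariants m x) :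
    m ≤ 6 ∨ ∃ i, m ≤ (x i).length := by
  rcases h.small with ⟨i, hi⟩ | ⟨hm, -⟩
  · refine .inr ⟨i, ?_⟩
    rw [← h.sum_eq i]
    simpa using List.sum_le_card_nsmul (x i) 1 hi
  · exact .inl hm

end ArmInvariants

/-! ### Growth of multiplicities and tripods in the support. -/

/-- The vectors of multiplicities obtained from a basis vector by increasing coordinates one at a
time, where the coordinate `j` of `c` may be increased if `∑ i, c i * w i j = 2 * c j + 1`. -/
inductive Growth {I : Type*} [Fintype I] [DecidableEq I] (w : I → I → ℕ) : (I → ℕ) → Prop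
  | single (i : I) : Growth w (Pi.single i 1)
  | step {c : I → ℕ} {j : I} : Growth w c → ∑ i, c i * w i j = 2 * c j + 1 →
      Growth w (Function.update c j (c j + 1))

theorem sum_mul_eq_of_forall {I : Type*} [Fintype I] {w : I → I → ℕ} {c f : I → ℕ} {v : I}
    (h : ∀ t, 0 < c t → w t v = f t) :
    ∑ t, c t * w t v = ∑ t, c t * f t := by
  refine Finset.sum_congr rfl fun t _ => ?_
  rcases Nat.eq_zero_or_pos (c t) with h0 | h0
  · simp [h0]
  · rw [h t h0]

section Arms

variable {I : Type*} [DecidableEq I]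

/-- `Arm w c u P x`: the list `P` is an arm issued from the vertex `u`, all of whose vertices but
possibly the last one have multiplicity at least `2`, and `x` is the list of successive differences
of the multiplicities along the arm. -/
inductive Arm (w : I → I → ℕ) (c : I → ℕ) : I → List I → List ℕ → Prop
  | opened {u v : I} {a : ℕ} : 0 < w u v → c v = 1 → c u = c v + a → Arm w c u [v] [a, 1]
  | leaf {u v : I} {a d : ℕ} : 0 < w u v → 2 ≤ c v →
      (∀ t, 0 < c t → w t v = if t = u then 1 else 0) → c u = c v + a → c v = d →
      Arm w c u [v] [a, d]
  | cons {u v v' : I} {P : List I} {a : ℕ} {x : List ℕ} : 0 < w u v → 2 ≤ c v →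
      (∀ t, 0 < c t → w t v = (if t = u then 1 else 0) + (if t = v' then 1 else 0)) →
      c u = c v + a → Arm w c v (v' :: P) x → Arm w c u (v :: v' :: P) (a :: x)

variable {w : I → I → ℕ} {c : I → ℕ} {u : I} {P : List I} {x : List ℕ}

namespace Arm

theorem pos (h : Arm w c u P x) : ∀ v ∈ P, 0 < c v := by
  induction h with
  | opened _ h => simp [h]
  | leaf _ h => simp; omega
  | cons _ h _ _ _ ih =>
    rw [List.forall_mem_cons]
    exact ⟨by omega, ih⟩

theorem le (h : Arm w c u P x) : ∀ v ∈ P, c v ≤ c u := by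
  induction h with
  | opened _ _ h => simp [h]
  | leaf _ _ _ h => simp [h]
  | cons _ _ _ h _ ih =>
    rw [List.forall_mem_cons]
    exact ⟨by omega, fun t ht => (ih t ht).trans (by omega)⟩

theorem length_eq (h : Arm w c u P x) : x.length = P.length + 1 := by
  induction h with
  | opened | leaf => rfl
  | cons _ _ _ _ _ ih => simp [ih]

theorem exists_eq_cons (h : Arm w c u P x) :
    ∃ v Q a r, P = v :: Q ∧ x = a :: r ∧ c u = c v + a := by
  cases h with
  | opened _ _ h => exact ⟨_, _, _, _, rfl, rfl, h⟩
  | leaf _ _ _ h => exact ⟨_, _, _, _, rfl, rfl, h⟩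
  | cons _ _ _ h => exact ⟨_, _, _, _, rfl, rfl, h⟩

/-- The constructors `leaf` and `cons` prescribe all neighbours in the support; only an `opened`
end, of multiplicity 1, may have others. -/
theorem mem_of_adj (h : Arm w c u P x) {t j : I} (ht : t ∈ P) (hct : 2 ≤ c t) (hj : 0 < c j)
    (hjt : 0 < w j t) : j ∈ u :: P := by
  induction h with
  | opened _ h =>
    simp only [List.mem_singleton] at ht
    subst ht
    omega
  | leaf _ _ h =>
    simp only [List.mem_singleton] at ht
    subst ht
    have := h j hj
    split_ifs at this with hju
    · simp [hju]
    · omega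
  | cons _ _ h _ _ ih =>
    rw [List.mem_cons] at ht
    rcases ht with rfl | ht
    · have := h j hj
      split_ifs at this with h1 h2 h2
      · simp [h1]
      · simp [h1]
      · simp [h2]
      · omega
    · exact List.mem_cons_of_mem _ (ih ht)

end Arm

/-- A vertex `b` of multiplicity at least `2`, together with the three arms issued from it. -/
structure Tripod (w : I → I → ℕ) (c : I → ℕ) (b : I) (P : Fin 3 → List I) (x : Fin 3 → List ℕ) :
    Prop where
  two_le : 2 ≤ c b
  weight_eq : ∀ t, 0 < c t → w t b = ∑ i, if (P i).head? = some t then 1 else 0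
  arm : ∀ i, Arm w c b (P i) (x i)
  nodup : ∀ i, (b :: P i).Nodup
  inv : ArmInvariants (c b) x

theorem Tripod.mem_of_adj {b : I} {P : Fin 3 → List I} {x : Fin 3 → List ℕ}
    (h : Tripod w c b P x) {t j : I} (ht : t = b ∨ ∃ i, t ∈ P i) (hct : 2 ≤ c t)
    (hj : 0 < c j) (hjt : 0 < w j t) : j = b ∨ ∃ i, j ∈ P i := by
  rcases ht with rfl | ⟨i, hi⟩
  · right
    rw [h.weight_eq j hj, Finset.sum_pos_iff] at hjt
    obtain ⟨i, -, hi⟩ := hjt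
    split_ifs at hi with h1
    · exact ⟨i, List.mem_of_head? h1⟩
    · omega
  · have := (h.arm i).mem_of_adj hi hct hj hjt
    rw [List.mem_cons] at this
    exact this.imp_right fun h => ⟨i, h⟩

variable [Fintype I]

/-- A vertex entering the support is not linked to the vertices of multiplicity at least `2`. -/
theorem weight_eq_of_step (hw : ∀ i j, w i j = 0 → w j i = 0) {j v : I}
    (hj : ∑ i, c i * w i j = 2 * c j + 1) (hv : 2 ≤ c v) {f : I → ℕ}
    (hf : ∀ t, 0 < c t → w t v = f t) (hf0 : ∀ t, c t = 0 → f t = 0) (t : I)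
    (ht : 0 < Function.update c j (c j + 1) t) : w t v = f t := by
  rcases Nat.eq_zero_or_pos (c t) with h0 | h0
  · obtain rfl : t = j := by
      by_contra h
      rw [Function.update_of_ne h] at ht
      omega
    -- When `t` enters the support the sum in `hj` is 1, while a link with `v` would contribute at
    -- least 2.
    have := Finset.single_le_sum (f := fun i => c i * w i t) (fun _ _ => Nat.zero_le _)
      (Finset.mem_univ v)
    simp only [hj, h0] at this
    rw [hf0 t h0]
    refine hw _ _ ?_
    by_contra h
    have : 1 ≤ w v t := Nat.one_le_iff_ne_zero.2 h
    nlinarith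
  · exact hf t h0

namespace Arm

/-- An increase at the vertex from which an arm is issued. -/
theorem step_head (hw : ∀ i j, w i j = 0 → w j i = 0) {a : ℕ} {r : List ℕ}
    (h : Arm w c u P (a :: r)) (hu : 0 < c u) (hnd : (u :: P).Nodup)
    (hj : ∑ i, c i * w i u = 2 * c u + 1) :
    Arm w (Function.update c u (c u + 1)) u P ((a + 1) :: r) := by
  have key : ∀ {v : I} {Q : List I} {y : List ℕ}, Arm w c v Q y → u ∉ v :: Q →
      Arm w (Function.update c u (c u + 1)) v Q y := by
    intro v Q y h
    induction h with
    | @opened v t a h1 h2 h3 =>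
      intro hn
      simp only [List.mem_cons, not_or, List.not_mem_nil, not_false_eq_true, and_true] at hn
      refine .opened h1 ?_ ?_ <;> simp [Function.update_of_ne (Ne.symm hn.1),
        Function.update_of_ne (Ne.symm hn.2), h2, h3]
    | @leaf v t a d h1 h2 h3 h4 h5 =>
      intro hn
      simp only [List.mem_cons, not_or, List.not_mem_nil, not_false_eq_true, and_true] at hn
      have e : Function.update c u (c u + 1) t = c t := Function.update_of_ne (Ne.symm hn.2) _ _
      refine .leaf h1 (by rwa [e]) (weight_eq_of_step hw hj h2 h3 fun s hs => ?_) ?_ (by rw [e, h5])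
      · rw [if_neg]
        rintro rfl
        omega
      · rw [e, Function.update_of_ne (Ne.symm hn.1), h4]
    | @cons v t t' P a x h1 h2 h3 h4 h5 ih =>
      intro hn
      rw [List.mem_cons, not_or] at hn
      have e : Function.update c u (c u + 1) t = c t :=
        Function.update_of_ne (fun h => hn.2 (by simp [h])) _ _
      refine .cons h1 (by rwa [e]) (weight_eq_of_step hw hj h2 h3 fun s hs => ?_) ?_ (ih hn.2)
      · have := h5.pos t' (by simp)
        rw [if_neg, if_neg]
        · rintro rfl
          omega
        · rintro rfl
          omega
      · rw [e, Function.update_of_ne (Ne.symm hn.1), h4]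
  have hup : u ∉ P := (List.nodup_cons.1 hnd).1
  cases h with
  | @opened _ v _ h1 h2 h3 =>
    have e : Function.update c u (c u + 1) v = c v :=
      Function.update_of_ne (fun h => hup (by simp [h])) _ _
    refine .opened h1 (by rw [e, h2]) ?_
    rw [e, Function.update_self, h3, add_assoc]
  | @leaf _ v _ d h1 h2 h3 h4 h5 =>
    have e : Function.update c u (c u + 1) v = c v :=
      Function.update_of_ne (fun h => hup (by simp [h])) _ _
    refine .leaf h1 (by rwa [e]) (weight_eq_of_step hw hj h2 h3 fun s hs => ?_) ?_ (by rw [e, h5])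
    · rw [if_neg]
      rintro rfl
      omega
    · rw [e, Function.update_self, h4, add_assoc]
  | @cons _ v v' Q _ x h1 h2 h3 h4 h5 =>
    have e : Function.update c u (c u + 1) v = c v :=
      Function.update_of_ne (fun h => hup (by simp [h])) _ _
    refine .cons h1 (by rwa [e]) (weight_eq_of_step hw hj h2 h3 fun s hs => ?_) ?_ (key h5 hup)
    · have := h5.pos v' (by simp)
      rw [if_neg, if_neg]
      · rintro rfl
        omega
      · rintro rfl
        omega
    · rw [e, Function.update_self, h4, add_assoc]

/-- The weighted sum at `v` is 3, of which `u` contributes at least 2. Either `c u = 3` and `v`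
becomes a leaf, or `c u = 2` and the one other neighbour, of multiplicity 1, becomes the new end of
the arm. -/
theorem step_open (hw0 : ∀ i, w i i = 0) (hw : ∀ i j, w i j = 0 → w j i = 0) {v : I}
    {a : ℕ} (huv : 0 < w u v) (hv : c v = 1) (ha : c u = c v + a) (hu : 2 ≤ c u)
    (hj : ∑ i, c i * w i v = 2 * c v + 1) :
    ∃ Q y, Arm w (Function.update c v (c v + 1)) u (v :: Q) y ∧ (u :: v :: Q).Nodup ∧
      (∀ t ∈ Q, c t = 1 ∧ t ≠ v) ∧ ArmMove [a, 1] y := by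
  have hne : u ≠ v := by
    rintro rfl
    simp [hw0] at huv
  have hsplit : c u * w u v + ∑ t ∈ Finset.univ.erase u, c t * w t v = 3 := by
    rw [Finset.add_sum_erase _ (fun t => c t * w t v) (Finset.mem_univ u), hj, hv]
  have hwuv : w u v = 1 := by
    refine le_antisymm ?_ huv
    by_contra! h
    have := Nat.mul_le_mul hu h
    omega
  rw [hwuv, mul_one] at hsplit
  have hself : Function.update c v (c v + 1) v = 2 := by simp [hv]
  have hu' : Function.update c v (c v + 1) u = c u := Function.update_of_ne hne _ _
  have hcu : c u = 3 ∨ c u = 2 := by omega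
  rcases hcu with hcu | hcu
  · have hz : ∑ t ∈ Finset.univ.erase u, c t * w t v = 0 := by omega
    rw [Finset.sum_eq_zero_iff] at hz
    obtain rfl : a = 2 := by omega
    refine ⟨[], [1, 2], ?_, by simpa using hne, by simp, .swap 1 []⟩
    refine .leaf huv (by rw [hself]) (fun t ht => ?_) (by rw [hu', hself, hcu]) hself
    split_ifs with h
    · rw [h, hwuv]
    · by_cases htv : t = v
      · rw [htv, hw0]
      · rw [Function.update_of_ne htv] at ht
        have := hz t (by simp [h])
        exact (Nat.mul_eq_zero.1 this).resolve_left ht.ne'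
  · have hz : ∑ t ∈ Finset.univ.erase u, c t * w t v = 1 := by omega
    obtain ⟨t, ht, ht0⟩ : ∃ t ∈ Finset.univ.erase u, c t * w t v ≠ 0 := by
      by_contra! h
      rw [Finset.sum_eq_zero h] at hz
      omega
    rw [← Finset.add_sum_erase _ _ ht] at hz
    have ht1 : c t * w t v = 1 := by omega
    have hz' : ∑ s ∈ (Finset.univ.erase u).erase t, c s * w s v = 0 := by omega
    rw [Finset.sum_eq_zero_iff] at hz'
    obtain ⟨hct, hwt⟩ := mul_eq_one.1 ht1
    have htu : t ≠ u := by simpa using ht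
    have htv : t ≠ v := by
      rintro rfl
      simp [hw0] at hwt
    obtain rfl : a = 1 := by omega
    have ht' : Function.update c v (c v + 1) t = 1 := by rw [Function.update_of_ne htv, hct]
    refine ⟨[t], [0, 1, 1], .cons huv hself.ge (fun s hs => ?_) (by rw [hu', hself, hcu])
      (.opened ?_ ht' (by rw [hself, ht'])), ?_, by simp [hct, htv], .grow⟩
    · by_cases hsu : s = u
      · rw [hsu, hwuv, if_pos rfl, if_neg htu.symm]
      by_cases hst : s = t
      · rw [hst, hwt, if_pos rfl, if_neg htu, zero_add]
      · rw [if_neg hsu, if_neg hst]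
        by_cases hsv : s = v
        · rw [hsv, hw0]
        · rw [Function.update_of_ne hsv] at hs
          exact (Nat.mul_eq_zero.1 (hz' s (by simp [hsu, hst]))).resolve_left hs.ne'
    · by_contra h
      have := hw v t (by omega)
      omega
    · simp [hne, htu.symm, htv.symm]

/-- An increase at a vertex other than the one from which the arm is issued. -/
theorem step (hw0 : ∀ i, w i i = 0) (hw : ∀ i j, w i j = 0 → w j i = 0) (h : Arm w c u P x)
    {j : I} (hu : 2 ≤ c u) (hnd : (u :: P).Nodup) (hj : ∑ i, c i * w i j = 2 * c j + 1)
    (hju : j ≠ u) :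
    ∃ P' y, Arm w (Function.update c j (c j + 1)) u P' y ∧ (u :: P').Nodup ∧
      P'.head? = P.head? ∧ P ⊆ P' ∧ (∀ t ∈ P', t ∈ P ∨ c t = 1) ∧ ArmMove x y := by
  induction h with
  | @opened u v a h1 h2 h3 =>
    by_cases hjv : j = v
    · subst hjv
      obtain ⟨Q, y, hQ, hnd', hQ1, hy⟩ := step_open hw0 hw h1 h2 h3 hu hj
      refine ⟨_, y, hQ, hnd', rfl, by simp, fun t ht => ?_, hy⟩
      rw [List.mem_cons] at ht
      exact ht.imp (by simp +contextual) fun h => (hQ1 t h).1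
    · refine ⟨[v], [a, 1], .opened h1 ?_ ?_, hnd, rfl, by simp, by simp, .refl _⟩ <;>
        simp [Function.update_of_ne (Ne.symm hjv), Function.update_of_ne (Ne.symm hju), h2, h3]
  | @leaf u v a d h1 h2 h3 h4 h5 =>
    have hsupp := weight_eq_of_step hw hj h2 h3 fun t ht => by
      rw [if_neg]
      rintro rfl
      omega
    have hu' : Function.update c j (c j + 1) u = c u := Function.update_of_ne (Ne.symm hju) _ _
    by_cases hjv : j = v
    · subst hjv
      have e := hj
      rw [sum_mul_eq_of_forall h3] at e
      simp only [mul_ite, mul_one, mul_zero, Finset.sum_ite_eq', Finset.mem_univ, if_true] at e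
      -- The increase condition reads `c u = 2 * c j + 1`: the two last entries are `c j + 1` and `c
      -- j`, and they get swapped.
      obtain rfl : a = c j + 1 := by omega
      have : Function.update c j (c j + 1) j = c j + 1 := by simp
      subst h5
      exact ⟨[j], [c j, c j + 1], .leaf h1 (by omega) hsupp (by rw [hu', this]; omega) this, hnd,
        rfl, by simp, by simp, .swap _ []⟩
    · have e : Function.update c j (c j + 1) v = c v := Function.update_of_ne (Ne.symm hjv) _ _
      exact ⟨[v], [a, d], .leaf h1 (by omega) hsupp (by rw [hu', e, h4]) (by rw [e, h5]), hnd, rfl,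
        by simp, by simp, .refl _⟩
  | @cons u v v' Q a x h1 h2 h3 h4 h5 ih =>
    have hv' := h5.pos v' (by simp)
    have hsupp := weight_eq_of_step hw hj h2 h3 fun t ht => by
      rw [if_neg, if_neg]
      · rintro rfl
        omega
      · rintro rfl
        omega
    have hu' : Function.update c j (c j + 1) u = c u := Function.update_of_ne (Ne.symm hju) _ _
    have hnd' := (List.nodup_cons.1 hnd).2
    have hup := (List.nodup_cons.1 hnd).1
    by_cases hjv : j = v
    · subst hjv
      have e := hj
      rw [sum_mul_eq_of_forall h3] at e
      simp only [mul_add, Finset.sum_add_distrib, mul_ite, mul_one, mul_zero, Finset.sum_ite_eq',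
        Finset.mem_univ, if_true] at e
      obtain ⟨v'', Q', b, r, hQ, rfl, hb⟩ := h5.exists_eq_cons
      obtain ⟨rfl, rfl⟩ : v' = v'' ∧ Q = Q' := by simpa using hQ
      -- The multiplicities of the two neighbours of `j` sum to `2 * c j + 1`, so the differences
      -- before and after `j` are `b + 1` and `b`.
      obtain rfl : a = b + 1 := by omega
      have h6 := h5.step_head hw (by omega) hnd' hj
      exact ⟨_, _, .cons h1 (by simp; omega) hsupp (by rw [hu', Function.update_self]; omega) h6,
        hnd, rfl, by simp, fun t ht => .inl ht, .swap _ _⟩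
    · have e : Function.update c j (c j + 1) v = c v := Function.update_of_ne (Ne.symm hjv) _ _
      obtain ⟨P', y, hP', hnd'', hhead, hsub, hmem, hy⟩ := ih h2 hnd' hjv
      obtain ⟨v'', Q', b, r, rfl, rfl, hb⟩ := hP'.exists_eq_cons
      obtain rfl : v'' = v' := by simpa using hhead
      refine ⟨_, _, .cons h1 (by omega) hsupp (by rw [hu', e, h4]) hP', ?_, rfl, ?_, ?_,
        .cons a hy⟩
      -- Vertices new to the arm had multiplicity 1, whereas `c u` is at least 2.
      · refine List.nodup_cons.2 ⟨fun hmu => ?_, hnd''⟩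
        rw [List.mem_cons] at hmu hup
        rcases hmu with rfl | hmu
        · exact hup (.inl rfl)
        · rcases hmem u hmu with h | h
          · exact hup (.inr h)
          · omega
      · exact List.cons_subset_cons _ hsub
      · intro t ht
        rw [List.mem_cons] at ht ⊢
        rcases ht with rfl | ht
        · exact .inl (.inl rfl)
        · exact (hmem t ht).imp_left .inr

end Arm

namespace Tripod

variable {b : I} {P : Fin 3 → List I} {x : Fin 3 → List ℕ}

/-- Multiplicities do not increase along an arm, so the centre carries the largest one; an arm with
its centre has no repeated vertex, which bounds its length. -/
theorem le (h : Tripod w c b P x) {v : I} (hv : v = b ∨ ∃ i, v ∈ P i) :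
    c v ≤ max 6 (Fintype.card I) := by
  have hb : c b ≤ max 6 (Fintype.card I) := by
    rcases h.inv.le_six_or_le_length with h6 | ⟨i, hi⟩
    · exact h6.trans (le_max_left _ _)
    · refine (hi.trans ?_).trans (le_max_right _ _)
      rw [(h.arm i).length_eq]
      exact (h.nodup i).length_le_card
  rcases hv with rfl | ⟨i, hi⟩
  · exact hb
  · exact ((h.arm i).le v hi).trans hb

theorem weight_eq_of_step (hw : ∀ i j, w i j = 0 → w j i = 0) (h : Tripod w c b P x) {j : I}
    (hj : ∑ i, c i * w i j = 2 * c j + 1) (t : I)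
    (ht : 0 < Function.update c j (c j + 1) t) :
    w t b = ∑ i, if (P i).head? = some t then 1 else 0 := by
  refine _root_.weight_eq_of_step hw hj h.two_le h.weight_eq (fun t ht => ?_) t ht
  refine Finset.sum_eq_zero fun i _ => if_neg fun hi => ?_
  have := (h.arm i).pos t (List.mem_of_head? hi)
  omega

/-- At the centre the condition is 3m - ∑ a_i = 2m + 1, the hypothesis of `central_step`. Elsewhere
each arm undergoes an `ArmMove`; arms need not be disjoint, so several may change at once. -/
theorem step (hw0 : ∀ i, w i i = 0) (hw : ∀ i j, w i j = 0 → w j i = 0) (h : Tripod w c b P x)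
    {j : I} (hj : ∑ i, c i * w i j = 2 * c j + 1) :
    ∃ P' x', Tripod w (Function.update c j (c j + 1)) b P' x' ∧ ∀ i, P i ⊆ P' i := by
  by_cases hjb : j = b
  · subst hjb
    choose v Q a r hP hx hva using fun i => (h.arm i).exists_eq_cons
    obtain rfl : x = fun i => a i :: r i := funext hx
    have e := hj
    rw [sum_mul_eq_of_forall h.weight_eq] at e
    simp only [hP, List.head?_cons, Option.some.injEq, Finset.mul_sum, mul_ite, mul_one,
      mul_zero] at e
    rw [Finset.sum_comm] at e
    simp only [Finset.sum_ite_eq, Finset.mem_univ, if_true] at e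
    refine ⟨P, fun i => (a i + 1) :: r i, ⟨?_, h.weight_eq_of_step hw hj, fun i => ?_, h.nodup, ?_⟩,
      fun i => List.Subset.refl _⟩
    · simpa using h.two_le.trans (Nat.le_succ _)
    · exact (h.arm i).step_head hw (by have := h.two_le; omega) (h.nodup i) hj
    · rw [Function.update_self]
      refine h.inv.central_step ?_
      have := hva 0
      have := hva 1
      have := hva 2
      simp only [Fin.sum_univ_three] at e ⊢
      omega
  · choose P' y hP' hnd hhead hsub _ hy using
      fun i => (h.arm i).step hw0 hw h.two_le (h.nodup i) hj hjb
    have e : Function.update c j (c j + 1) b = c b := Function.update_of_ne (Ne.symm hjb) _ _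
    refine ⟨P', y, ⟨by rw [e]; exact h.two_le, ?_, hP', hnd, ?_⟩, hsub⟩
    · simpa only [hhead] using h.weight_eq_of_step hw hj
    · rw [e]
      exact h.inv.move hy

/-- The star centred at a vertex whose multiplicity becomes `2` when all its neighbours have
multiplicity `1`. -/
theorem exists_new (hw0 : ∀ i, w i i = 0) (hw : ∀ i j, w i j = 0 → w j i = 0) {j : I}
    (hcj : c j = 1) (hj : ∑ i, c i * w i j = 2 * c j + 1)
    (hone : ∀ t, 0 < c t → 0 < w t j → c t = 1) :
    ∃ P x, Tripod w (Function.update c j (c j + 1)) j P x := by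
  -- Neighbours are repeated according to their weights, so one vertex may start several arms.
  set s : Multiset I := ∑ t, Multiset.replicate (c t * w t j) t with hs
  have hcard : s.card = 3 := by
    rw [hs, Multiset.card_sum]
    simp only [Multiset.card_replicate]
    rw [hj, hcj]
  have hcount : ∀ t, s.count t = c t * w t j := by
    intro t
    rw [hs, Multiset.count_sum']
    simp [Multiset.count_replicate]
  obtain ⟨t₀, t₁, t₂, hst⟩ := Multiset.card_eq_three.1 hcard
  let v : Fin 3 → I := ![t₀, t₁, t₂]
  have hv : ∀ t, s.count t = ∑ i, if v i = t then 1 else 0 := by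
    intro t
    rw [hst]
    simp only [Fin.sum_univ_three, v, Multiset.insert_eq_cons, Multiset.count_cons,
      Multiset.count_singleton]
    simp only [Matrix.cons_val, eq_comm (a := t), add_comm, add_left_comm]
    congr!
  have hvpos : ∀ i, 0 < c (v i) ∧ 0 < w (v i) j := by
    intro i
    have : 0 < s.count (v i) := by
      rw [hv]
      exact Finset.sum_pos_iff.2 ⟨i, Finset.mem_univ _, by simp⟩
    rw [hcount] at this
    exact ⟨Nat.pos_of_mul_pos_right this, Nat.pos_of_mul_pos_left this⟩
  have hvj : ∀ i, v i ≠ j := by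
    intro i hi
    have := (hvpos i).2
    rw [hi, hw0] at this
    omega
  have hv1 : ∀ i, Function.update c j (c j + 1) (v i) = 1 := by
    intro i
    rw [Function.update_of_ne (hvj i)]
    exact hone _ (hvpos i).1 (hvpos i).2
  have hj2 : Function.update c j (c j + 1) j = 2 := by simp [hcj]
  refine ⟨fun i => [v i], fun _ => [1, 1], ⟨hj2.ge, fun t ht => ?_, fun i => ?_, fun i => ?_, ?_⟩⟩
  · simp only [List.head?_cons, Option.some.injEq]
    rw [← hv, hcount]
    rcases Nat.eq_zero_or_pos (w t j) with h0 | h0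
    · simp [h0]
    · have htj : t ≠ j := by
        rintro rfl
        simp [hw0] at h0
      rw [Function.update_of_ne htj] at ht
      rw [hone t ht h0, one_mul]
  · refine .opened (Nat.pos_of_ne_zero fun h => ?_) (hv1 i) (by rw [hj2, hv1])
    have := (hvpos i).2
    rw [hw _ _ h] at this
    omega
  · simpa using (hvj i).symm
  · rw [hj2]
    exact .initial

end Tripod

/-- A vertex reaching multiplicity 2 either has only neighbours of multiplicity 1 in the support and
becomes a centre, or is adjacent to a vertex of multiplicity at least 2, whose tripod already
contains it. -/
theorem Growth.exists_tripod (hw0 : ∀ i, w i i = 0) (hw : ∀ i j, w i j = 0 → w j i = 0)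
    (h : Growth w c) : ∀ v, 2 ≤ c v → ∃ b P x, Tripod w c b P x ∧ (v = b ∨ ∃ i, v ∈ P i) := by
  induction h with
  | single i =>
    intro v hv
    rcases eq_or_ne v i with rfl | h
    · simp at hv
    · simp [Pi.single_eq_of_ne h] at hv
  | @step c j _ hj ih =>
    have old : ∀ v b P x, Tripod w c b P x → (v = b ∨ ∃ i, v ∈ P i) →
        ∃ b P x, Tripod w (Function.update c j (c j + 1)) b P x ∧ (v = b ∨ ∃ i, v ∈ P i) := by
      intro v b P x hS hv
      obtain ⟨P', x', hS', hsub⟩ := hS.step hw0 hw hj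
      exact ⟨b, P', x', hS', hv.imp_right fun ⟨i, hi⟩ => ⟨i, hsub i hi⟩⟩
    intro v hv
    by_cases hcv : 2 ≤ c v
    · obtain ⟨b, P, x, hS, hm⟩ := ih v hcv
      exact old v b P x hS hm
    · obtain rfl : v = j := by
        by_contra h
        rw [Function.update_of_ne h] at hv
        exact hcv hv
      rw [Function.update_self] at hv
      have hv1 : c v = 1 := by omega
      by_cases hone : ∀ t, 0 < c t → 0 < w t v → c t = 1
      · obtain ⟨P, x, hS⟩ := Tripod.exists_new hw0 hw hv1 hj hone
        exact ⟨v, P, x, hS, .inl rfl⟩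
      · push Not at hone
        obtain ⟨t, ht, htv, ht1⟩ := hone
        obtain ⟨b, P, x, hS, hm⟩ := ih t (by omega)
        refine old v b P x hS (hS.mem_of_adj hm (by omega) (by omega) (Nat.pos_of_ne_zero fun h => ?_))
        rw [hw _ _ h] at htv
        omega

theorem Growth.le_max (hw0 : ∀ i, w i i = 0) (hw : ∀ i j, w i j = 0 → w j i = 0)
    (h : Growth w c) (v : I) : c v ≤ max 6 (Fintype.card I) := by
  rcases lt_or_ge (c v) 2 with hv | hv
  · exact le_max_of_le_left (by omega)
  · obtain ⟨b, P, x, hS, hm⟩ := h.exists_tripod hw0 hw v hv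
    exact hS.le hm

end Arms

/-- Beyond the small cases, (1 + 1/n)^n ≤ e < 3. -/
theorem pow_succ_max_six_le {n : ℕ} (hn : 2 ≤ n) : (max 6 n + 1) ^ n ≤ n ^ (n + 5) := by
  rcases le_or_gt n 6 with h | h
  · interval_cases n <;> norm_num
  · rw [max_eq_right h.le, pow_add]
    have h1 : ((n : ℝ) + 1) ^ n ≤ n ^ n * 3 := by
      have hn0 : (0 : ℝ) < n := by positivity
      have h2 : ((n : ℝ) + 1) = n * (1 / n + 1) := by field_simp; ring
      rw [h2, mul_pow]
      gcongr
      calc (1 / (n : ℝ) + 1) ^ n ≤ Real.exp (1 / n) ^ n := by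
            gcongr; exact Real.add_one_le_exp _
        _ = Real.exp 1 := by rw [← Real.exp_nat_mul]; congr 1; field_simp
        _ ≤ 3 := Real.exp_one_lt_three.le
    have h3 : (n + 1) ^ n ≤ n ^ n * 3 := by exact_mod_cast h1
    refine h3.trans (Nat.mul_le_mul_left _ ?_)
    calc 3 ≤ n ^ 1 := by rw [pow_one]; omega
      _ ≤ n ^ 5 := Nat.pow_le_pow_right (by omega) (by omega)

/-! ### Word length in a group generated by involutions. -/

section WordLength

variable {G I : Type*} [Group G] (s : I → G)

/-- The minimal length of a word in the `s i` representing `g`. -/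
noncomputable def wordLength (g : G) : ℕ :=
  sInf {k | ∃ l : List I, l.length = k ∧ (l.map s).prod = g}

/-- The alternating product of `k` factors `s i` and `s j`, ending with `s j` on the right. -/
def alternatingProd (i j : I) : ℕ → G
  | 0 => 1
  | k + 1 => s (if Even k then j else i) * alternatingProd i j k

variable {s}

theorem alternatingProd_succ' (i j : I) (k : ℕ) :
    alternatingProd s i j (k + 1) = alternatingProd s j i k * s j := by
  induction k with
  | zero => simp [alternatingProd]
  | succ k ih =>
    rw [alternatingProd, ih, ← mul_assoc]
    congr 1
    rw [alternatingProd]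
    by_cases h : Even k <;> simp [h, Nat.even_add_one]

theorem wordLength_le (l : List I) : wordLength s (l.map s).prod ≤ l.length :=
  Nat.sInf_le ⟨l, rfl, rfl⟩

theorem exists_list_length_eq_wordLength (hs : ∀ i, s i * s i = 1)
    (hgen : Subgroup.closure (Set.range s) = ⊤) (g : G) :
    ∃ l : List I, l.length = wordLength s g ∧ (l.map s).prod = g := by
  refine Nat.sInf_mem (s := {k | ∃ l : List I, l.length = k ∧ (l.map s).prod = g}) ?_
  suffices ∃ l : List I, (l.map s).prod = g by
    obtain ⟨l, hl⟩ := this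
    exact ⟨_, l, rfl, hl⟩
  have hg : g ∈ Subgroup.closure (Set.range s) := hgen ▸ Subgroup.mem_top g
  induction hg using Subgroup.closure_induction with
  | mem x hx =>
    obtain ⟨i, rfl⟩ := hx
    exact ⟨[i], by simp⟩
  | one => exact ⟨[], rfl⟩
  | mul x y _ _ hx hy =>
    obtain ⟨l, rfl⟩ := hx
    obtain ⟨l', rfl⟩ := hy
    exact ⟨l ++ l', by simp⟩
  | inv x _ hx =>
    obtain ⟨l, rfl⟩ := hx
    refine ⟨l.reverse, ?_⟩
    rw [List.prod_inv_reverse, List.map_reverse, List.map_map]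
    congr 2
    exact List.map_congr_left fun i _ => (inv_eq_of_mul_eq_one_left (hs i)).symm

theorem wordLength_mul_le (hs : ∀ i, s i * s i = 1)
    (hgen : Subgroup.closure (Set.range s) = ⊤) (g : G) (i : I) :
    wordLength s (g * s i) ≤ wordLength s g + 1 := by
  obtain ⟨l, hl, rfl⟩ := exists_list_length_eq_wordLength hs hgen g
  rw [← hl]
  simpa using wordLength_le (s := s) (l ++ [i])

theorem wordLength_mul_alternatingProd_le (hs : ∀ i, s i * s i = 1)
    (hgen : Subgroup.closure (Set.range s) = ⊤) (g : G) (i j : I) (k : ℕ) :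
    wordLength s (g * alternatingProd s i j k) ≤ wordLength s g + k := by
  induction k generalizing i j with
  | zero => simp [alternatingProd]
  | succ k ih =>
    rw [alternatingProd_succ', ← mul_assoc]
    have := wordLength_mul_le hs hgen (g * alternatingProd s j i k) j
    have := ih j i
    omega

theorem eq_one_or_exists_wordLength_mul_lt (hs : ∀ i, s i * s i = 1)
    (hgen : Subgroup.closure (Set.range s) = ⊤) (g : G) :
    g = 1 ∨ ∃ j, wordLength s (g * s j) + 1 ≤ wordLength s g := by
  obtain ⟨l, hl, hg⟩ := exists_list_length_eq_wordLength hs hgen g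
  rcases List.eq_nil_or_concat l with rfl | ⟨l, j, rfl⟩
  · exact .inl (by simpa using hg.symm)
  · refine .inr ⟨j, ?_⟩
    rw [← hl]
    have : g * s j = (l.map s).prod := by
      rw [← hg]
      simp [mul_assoc, hs]
    rw [this]
    simpa using wordLength_le (s := s) l

end WordLength

/-! ### Signs of roots under the braid relations. -/

/-- A group generated by involutions `s i` acting on a `ℤ`-module by the reflections attached to
linearly independent vectors with a generalized Cartan matrix, and satisfying the braid relations
prescribed by this matrix. -/
structure ReflectionRep {I G : Type*} [Group G] (A : Matrix I I ℤ) (s : I → G) (M : Type*)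
    [AddCommGroup M] where
  isGCM : IsGeneralizedCartanMatrix A
  mul_self : ∀ i, s i * s i = 1
  closure_eq : Subgroup.closure (Set.range s) = ⊤
  braid_two : ∀ i j, i ≠ j → A i j * A j i = 0 → alternatingProd s i j 2 = alternatingProd s j i 2
  braid_three : ∀ i j, i ≠ j → A i j * A j i = 1 →
    alternatingProd s i j 3 = alternatingProd s j i 3
  braid_four : ∀ i j, i ≠ j → A i j * A j i = 2 →
    alternatingProd s i j 4 = alternatingProd s j i 4
  braid_six : ∀ i j, i ≠ j → A i j * A j i = 3 →
    alternatingProd s i j 6 = alternatingProd s j i 6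
  rho : G →* (M ≃ₗ[ℤ] M)
  root : I → M
  form : I → M →ₗ[ℤ] ℤ
  form_root : ∀ i j, form i (root j) = A i j
  rho_apply : ∀ i x, rho (s i) x = x - form i x • root i
  linearIndependent : LinearIndependent ℤ root

namespace ReflectionRep

variable {I G M : Type*} [Group G] {A : Matrix I I ℤ} {s : I → G} [AddCommGroup M]
  (R : ReflectionRep A s M)

theorem rho_root (i j : I) : R.rho (s i) (R.root j) = R.root j - A i j • R.root i := by
  rw [R.rho_apply, R.form_root]

theorem rho_root_self (i : I) : R.rho (s i) (R.root i) = -R.root i := by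
  rw [R.rho_root, R.isGCM.diag]
  module

theorem root_ne_zero (i : I) : R.root i ≠ 0 := R.linearIndependent.ne_zero i

theorem rho_root_ne_zero (g : G) (i : I) : R.rho g (R.root i) ≠ 0 := by
  simpa using R.root_ne_zero i

theorem form_inv_apply_self (g : G) (i : I) : R.form i (R.rho g⁻¹ (R.rho g (R.root i))) = 2 := by
  rw [← LinearEquiv.mul_apply, ← map_mul, inv_mul_cancel, map_one, LinearEquiv.coe_one, id,
    R.form_root, R.isGCM.diag]

theorem rho_conj_apply (g : G) (i : I) (x : M) :
    R.rho (g * s i * g⁻¹) x = x - R.form i (R.rho g⁻¹ x) • R.rho g (R.root i) := by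
  rw [map_mul, map_mul, LinearEquiv.mul_apply, LinearEquiv.mul_apply, R.rho_apply, map_sub,
    map_zsmul, ← LinearEquiv.mul_apply, ← map_mul, mul_inv_cancel, map_one, LinearEquiv.coe_one,
    id]

/-- The images of a simple root under the dihedral group generated by two simple reflections. -/
theorem alternatingProd_root {i j : I} (hij : i ≠ j) (k : ℕ) :
    (∃ m, 1 ≤ m ∧ m ≤ k ∧ alternatingProd s i j m = alternatingProd s j i m) ∨
      ∃ p q : ℕ, R.rho (alternatingProd s i j k) (R.root i) = p • R.root i + q • R.root j := by
  obtain ⟨a, ha⟩ := Int.eq_ofNat_of_zero_le (neg_nonneg.2 (R.isGCM.nonpos j i hij.symm))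
  obtain ⟨b, hb⟩ := Int.eq_ofNat_of_zero_le (neg_nonneg.2 (R.isGCM.nonpos i j hij))
  have ha' : A j i = -a := by omega
  have hb' : A i j = -b := by omega
  have hab : A i j * A j i = (a * b : ℕ) := by rw [ha', hb']; push_cast; ring
  have hsj (p q : ℤ) : R.rho (s j) (p • R.root i + q • R.root j)
      = p • R.root i + (a * p - q) • R.root j := by
    rw [map_add, map_zsmul, map_zsmul, R.rho_root_self, R.rho_root, ha']
    module
  have hsi (p q : ℤ) : R.rho (s i) (p • R.root i + q • R.root j)
      = (b * q - p) • R.root i + q • R.root j := by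
    rw [map_add, map_zsmul, map_zsmul, R.rho_root_self, R.rho_root, hb']
    module
  have h0 : R.rho (alternatingProd s i j 0) (R.root i)
      = (1 : ℤ) • R.root i + (0 : ℤ) • R.root j := by
    simp [alternatingProd]
  have even_step {k : ℕ} (hk : Even k) {p q : ℤ}
      (h : R.rho (alternatingProd s i j k) (R.root i) = p • R.root i + q • R.root j) :
      R.rho (alternatingProd s i j (k + 1)) (R.root i)
        = p • R.root i + (a * p - q) • R.root j := by
    rw [alternatingProd, if_pos hk, map_mul, LinearEquiv.mul_apply, h, hsj]
  have odd_step {k : ℕ} (hk : ¬ Even k) {p q : ℤ}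
      (h : R.rho (alternatingProd s i j k) (R.root i) = p • R.root i + q • R.root j) :
      R.rho (alternatingProd s i j (k + 1)) (R.root i)
        = (b * q - p) • R.root i + q • R.root j := by
    rw [alternatingProd, if_neg hk, map_mul, LinearEquiv.mul_apply, h, hsi]
  have ofInt {k : ℕ} {p q : ℤ} (hp : 0 ≤ p) (hq : 0 ≤ q)
      (h : R.rho (alternatingProd s i j k) (R.root i) = p • R.root i + q • R.root j) :
      ∃ p q : ℕ, R.rho (alternatingProd s i j k) (R.root i) = p • R.root i + q • R.root j := by
    lift p to ℕ using hp
    lift q to ℕ using hq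
    exact ⟨p, q, by simpa using h⟩
  have h1 := even_step (by decide) h0
  have h2 := odd_step (by decide) h1
  have h3 := even_step (by decide) h2
  have h4 := odd_step (by decide) h3
  have h5 := even_step (by decide) h4
  rcases le_or_gt 4 (a * b) with h | h
  · right
    -- The first inequality of each pair says that the next reflection does not lower the
    -- coefficient it changes; the second one, with ab ≥ 4, reproduces the pair.
    have key : ∃ p q : ℤ, 0 ≤ p ∧ 0 ≤ q ∧
        R.rho (alternatingProd s i j k) (R.root i) = p • R.root i + q • R.root j ∧
        (Even k → 2 * q ≤ a * p ∧ b * q ≤ 2 * p) ∧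
        (¬ Even k → 2 * p ≤ b * q ∧ a * p ≤ 2 * q) := by
      have h' : (4 : ℤ) ≤ a * b := by exact_mod_cast h
      induction k with
      | zero => exact ⟨1, 0, by simp, le_rfl, h0, by simp, by simp⟩
      | succ k ih =>
        obtain ⟨p, q, hp, hq, hpq, he, ho⟩ := ih
        by_cases hk : Even k
        · obtain ⟨e1, e2⟩ := he hk
          refine ⟨p, a * p - q, hp, by linarith, even_step hk hpq, fun h => ?_, fun _ => ⟨?_, ?_⟩⟩
          · simp [Nat.even_add_one, hk] at h
          · nlinarith
          · linarith
        · obtain ⟨o1, o2⟩ := ho hk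
          refine ⟨b * q - p, q, by linarith, hq, odd_step hk hpq, fun _ => ⟨?_, ?_⟩, fun h => ?_⟩
          · nlinarith
          · linarith
          · simp [Nat.even_add_one, hk] at h
    obtain ⟨p, q, hp, hq, hpq, -⟩ := key
    exact ofInt hp hq hpq
  · have braid (m : ℕ) (hm : 1 ≤ m) (h : alternatingProd s i j m = alternatingProd s j i m)
        (hlt : k < m → ∃ p q : ℕ,
          R.rho (alternatingProd s i j k) (R.root i) = p • R.root i + q • R.root j) :
        (∃ m, 1 ≤ m ∧ m ≤ k ∧ alternatingProd s i j m = alternatingProd s j i m) ∨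
        ∃ p q : ℕ, R.rho (alternatingProd s i j k) (R.root i) = p • R.root i + q • R.root j := by
      rcases le_or_gt m k with hmk | hmk
      · exact .inl ⟨m, hm, hmk, h⟩
      · exact .inr (hlt hmk)
    have hab0 : (a : ℤ) * b = 0 ∨ (a : ℤ) * b = 1 ∨ (a : ℤ) * b = 2 ∨ (a : ℤ) * b = 3 := by
      norm_cast
      omega
    have hnn : (0 : ℤ) ≤ a := by positivity
    rcases hab0 with h | h | h | h
    · have ha0 : a = 0 := by
        rcases mul_eq_zero.1 h with h | h
        · exact_mod_cast h
        · have := R.isGCM.zero_symm i j (by rw [hb', h, neg_zero])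
          omega
      refine braid 2 (by norm_num) (R.braid_two i j hij (by rw [hab]; push_cast; exact h))
        fun hk => ?_
      interval_cases k
      · exact ofInt (by norm_num) le_rfl h0
      · exact ofInt (by norm_num) (by simp) h1
    · refine braid 3 (by norm_num) (R.braid_three i j hij (by rw [hab]; push_cast; exact h))
        fun hk => ?_
      interval_cases k
      · exact ofInt (by norm_num) le_rfl h0
      · exact ofInt (by norm_num) (by linarith) h1
      · exact ofInt (by linarith) (by linarith) h2
    · refine braid 4 (by norm_num) (R.braid_four i j hij (by rw [hab]; push_cast; exact h))
        fun hk => ?_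
      interval_cases k
      · exact ofInt (by norm_num) le_rfl h0
      · exact ofInt (by norm_num) (by linarith) h1
      · exact ofInt (by linarith) (by linarith) h2
      · exact ofInt (by linarith) (by nlinarith) h3
    · refine braid 6 (by norm_num) (R.braid_six i j hij (by rw [hab]; push_cast; exact h))
        fun hk => ?_
      interval_cases k
      · exact ofInt (by norm_num) le_rfl h0
      · exact ofInt (by norm_num) (by linarith) h1
      · exact ofInt (by linarith) (by linarith) h2
      · exact ofInt (by linarith) (by nlinarith) h3
      · exact ofInt (by nlinarith) (by nlinarith) h4
      · exact ofInt (by nlinarith) (le_of_eq (by linear_combination (-(a : ℤ) * (a * b - 1)) * h)) h5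

variable [Fintype I]

/-- The cone of combinations of the simple roots with coefficients in `ℕ`. -/
def IsNonneg (x : M) : Prop := ∃ c : I → ℕ, x = ∑ i, c i • R.root i

variable {R}

theorem IsNonneg.add {x y : M} (hx : R.IsNonneg x) (hy : R.IsNonneg y) : R.IsNonneg (x + y) := by
  obtain ⟨c, rfl⟩ := hx
  obtain ⟨d, rfl⟩ := hy
  exact ⟨c + d, by simp [add_smul, Finset.sum_add_distrib]⟩

theorem IsNonneg.nsmul {x : M} (hx : R.IsNonneg x) (n : ℕ) : R.IsNonneg (n • x) := by
  obtain ⟨c, rfl⟩ := hx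
  exact ⟨n • c, by simp [Finset.smul_sum, mul_smul]⟩

variable (R)

theorem isNonneg_root (i : I) : R.IsNonneg (R.root i) := by
  classical
  exact ⟨Pi.single i 1, by simp [Pi.single_apply, ite_smul]⟩

theorem eq_of_sum_eq {c d : I → ℤ} (h : ∑ i, c i • R.root i = ∑ i, d i • R.root i) (i : I) :
    c i = d i := by
  have h' : ∑ i, (c i - d i) • R.root i = 0 := by
    simp [sub_smul, Finset.sum_sub_distrib, h]
  exact sub_eq_zero.1 (Fintype.linearIndependent_iff.1 R.linearIndependent _ h' i)

variable {R}

theorem IsNonneg.eq_zero {x : M} (hx : R.IsNonneg x) (hx' : R.IsNonneg (-x)) : x = 0 := by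
  obtain ⟨c, rfl⟩ := hx
  obtain ⟨d, hd⟩ := hx'
  refine Finset.sum_eq_zero fun i _ => ?_
  have := R.eq_of_sum_eq (c := fun i => -(c i : ℤ)) (d := fun i => d i)
    (by simpa [Finset.sum_neg_distrib] using hd) i
  rw [show c i = 0 by omega, zero_smul]

variable (R)

/-- If `g` is not longer than `g * s i`, then `g` maps the `i`-th simple root to a nonnegative
combination of the simple roots. -/
theorem isNonneg_rho_root (g : G) (i : I) (h : wordLength s g ≤ wordLength s (g * s i)) :
    R.IsNonneg (R.rho g (R.root i)) := by
  induction hN : wordLength s g using Nat.strong_induction_on generalizing g i with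
  | _ N ih =>
  subst hN
  have hmul := wordLength_mul_le R.mul_self R.closure_eq
  have halt := wordLength_mul_alternatingProd_le R.mul_self R.closure_eq
  rcases eq_one_or_exists_wordLength_mul_lt R.mul_self R.closure_eq g with rfl | ⟨j, hj⟩
  · simpa using R.isNonneg_root i
  have hij : i ≠ j := by
    rintro rfl
    omega
  -- Strip from the right of `g` a longest alternating word in `s i`, `s j` along which lengths add.
  -- The remaining `v` is shorter than `g` and is shortened by neither `s i` nor `s j`, so induction
  -- applies to it.
  let S : ℕ → Prop := fun k =>
    ∃ v, g = v * alternatingProd s i j k ∧ wordLength s v + k = wordLength s g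
  have hS1 : S 1 := by
    refine ⟨g * s j, by simp [alternatingProd, mul_assoc, R.mul_self], ?_⟩
    have := hmul (g * s j) j
    rw [mul_assoc, R.mul_self, mul_one] at this
    omega
  have hSle : ∀ k, S k → k ≤ wordLength s g := fun k ⟨v, _, hv⟩ => by omega
  have hSdown : ∀ k, S (k + 1) → S k := by
    rintro k ⟨v, hv, hl⟩
    rw [alternatingProd, ← mul_assoc] at hv
    refine ⟨_, hv, ?_⟩
    have h1 := hmul v (if Even k then j else i)
    have h2 := halt (v * s (if Even k then j else i)) i j k
    rw [← hv] at h2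
    omega
  have hSmono : ∀ m k, m ≤ k → S k → S m := by
    intro m k hmk
    induction hmk with
    | refl => exact id
    | step _ ih' => exact fun h => ih' (hSdown _ h)
  classical
  obtain ⟨k, hk1, hSk, hSk'⟩ : ∃ k, 1 ≤ k ∧ S k ∧ ¬ S (k + 1) := by
    refine ⟨Nat.findGreatest S (wordLength s g), Nat.le_findGreatest (hSle 1 hS1) hS1,
      Nat.findGreatest_spec (hSle 1 hS1) hS1, fun hn => ?_⟩
    have := Nat.le_findGreatest (hSle _ hn) hn
    omega
  obtain ⟨v, hv, hl⟩ := hSk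
  have hnext : wordLength s v ≤ wordLength s (v * s (if Even k then j else i)) := by
    by_contra! hlt
    refine hSk' ⟨v * s (if Even k then j else i), ?_, ?_⟩
    · rw [alternatingProd, mul_assoc, ← mul_assoc (s _) (s _), R.mul_self, one_mul]
      exact hv
    · have := hmul (v * s (if Even k then j else i)) (if Even k then j else i)
      rw [mul_assoc, R.mul_self, mul_one] at this
      omega
  have hprev : wordLength s v ≤ wordLength s (v * s (if Even k then i else j)) := by
    obtain ⟨l, rfl⟩ : ∃ l, k = l + 1 := ⟨k - 1, by omega⟩
    have e : (if Even (l + 1) then i else j) = if Even l then j else i := by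
      by_cases h : Even l <;> simp [h, Nat.even_add_one]
    rw [alternatingProd, ← mul_assoc] at hv
    have := halt (v * s (if Even l then j else i)) i j l
    rw [e]
    rw [← hv] at this
    omega
  have hvi : R.IsNonneg (R.rho v (R.root i)) := by
    refine ih _ (by omega) v i ?_ rfl
    by_cases h : Even k
    · simpa [h] using hprev
    · simpa [h] using hnext
  have hvj : R.IsNonneg (R.rho v (R.root j)) := by
    refine ih _ (by omega) v j ?_ rfl
    by_cases h : Even k
    · simpa [h] using hnext
    · simpa [h] using hprev
  rcases R.alternatingProd_root hij k with ⟨m, hm, hmk, hbraid⟩ | ⟨p, q, hpq⟩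
  -- A braid relation of length m ≤ k rewrites the end of `g` so that it finishes with `s i`, making
  -- `g * s i` shorter than `g`.
  · exfalso
    obtain ⟨u, hu, hul⟩ := hSmono m k hmk ⟨v, hv, hl⟩
    obtain ⟨l, rfl⟩ : ∃ l, m = l + 1 := ⟨m - 1, by omega⟩
    rw [hbraid, alternatingProd_succ', ← mul_assoc] at hu
    have := halt u i j l
    have e : u * alternatingProd s i j l = g * s i := by
      rw [hu, mul_assoc, R.mul_self, mul_one]
    rw [e] at this
    omega
  · rw [hv, map_mul, LinearEquiv.mul_apply, hpq, map_add, map_nsmul, map_nsmul]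
    exact (hvi.nsmul p).add (hvj.nsmul q)

theorem isNonneg_neg_rho_root (g : G) (i : I) (h : wordLength s (g * s i) < wordLength s g) :
    R.IsNonneg (-R.rho g (R.root i)) := by
  have := R.isNonneg_rho_root (g * s i) i (by rw [mul_assoc, R.mul_self, mul_one]; exact h.le)
  rwa [map_mul, LinearEquiv.mul_apply, R.rho_root_self, map_neg] at this

theorem isNonneg_or_isNonneg_neg (g : G) (i : I) :
    R.IsNonneg (R.rho g (R.root i)) ∨ R.IsNonneg (-R.rho g (R.root i)) :=
  (le_or_gt _ _).imp (R.isNonneg_rho_root g i) (R.isNonneg_neg_rho_root g i)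

theorem wordLength_le_of_isNonneg {g : G} {i : I} (h : R.IsNonneg (R.rho g (R.root i))) :
    wordLength s g ≤ wordLength s (g * s i) := by
  by_contra! hlt
  exact R.rho_root_ne_zero g i (h.eq_zero (R.isNonneg_neg_rho_root g i hlt))

/-- A nontrivial element is shortened by some `s j`, hence makes that simple root negative. This
gives equality in the group although the roots need not span `M`. -/
theorem eq_one_of_isNonneg {g : G} (h : ∀ i, R.IsNonneg (R.rho g (R.root i))) : g = 1 := by
  rcases eq_one_or_exists_wordLength_mul_lt R.mul_self R.closure_eq g with hg | ⟨j, hj⟩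
  · exact hg
  · have := R.wordLength_le_of_isNonneg (h j)
    omega

theorem not_isNonneg_add_smul {j k : I} (hjk : k ≠ j) {h : ℤ} (hh : h < 0) :
    ¬ R.IsNonneg (R.root k + h • R.root j) ∧ ¬ R.IsNonneg (-(R.root k + h • R.root j)) := by
  classical
  have e : R.root k + h • R.root j = ∑ i, (Pi.single k 1 + Pi.single j h : I → ℤ) i • R.root i := by
    simp [add_smul, Finset.sum_add_distrib, Pi.single_apply, ite_smul]
  constructor
  · rintro ⟨c, hc⟩
    have := R.eq_of_sum_eq (c := (Pi.single k 1 + Pi.single j h : I → ℤ)) (d := fun i => c i)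
      (by rw [← e, hc]; simp) j
    simp [hjk.symm] at this
    omega
  · rintro ⟨c, hc⟩
    have := R.eq_of_sum_eq (c := (Pi.single k 1 + Pi.single j h : I → ℤ)) (d := fun i => -c i)
      (by rw [← e, ← neg_neg (R.root k + h • R.root j), hc]; simp) k
    simp [hjk] at this
    omega

/-- An element mapping a simple root to a simple root conjugates the simple reflections. -/
theorem conj_eq_of_rho_root_eq {g : G} {i j : I} (h : R.rho g (R.root i) = R.root j) :
    g * s i * g⁻¹ = s j := by
  have hF : R.form i (R.rho g⁻¹ (R.root j)) = 2 := by rw [← h, R.form_inv_apply_self]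
  -- The two products of the reflections are x ↦ x ± f(x) α_j, with f the difference of their forms.
  -- If f(α_k) ≠ 0 with k ≠ j, one of them sends α_k to a root with coordinates of both signs.
  have hT (x : M) : R.rho (s j * (g * s i * g⁻¹)) x
      = x + (R.form i (R.rho g⁻¹ x) - R.form j x) • R.root j := by
    rw [map_mul, LinearEquiv.mul_apply, R.rho_conj_apply, h, map_sub, map_zsmul, R.rho_root_self,
      R.rho_apply]
    module
  have hT' (x : M) : R.rho (g * s i * g⁻¹ * s j) x
      = x + (R.form j x - R.form i (R.rho g⁻¹ x)) • R.root j := by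
    rw [map_mul, LinearEquiv.mul_apply, R.rho_conj_apply, h, R.rho_apply, map_sub, map_zsmul,
      map_sub, map_zsmul, hF, smul_eq_mul]
    module
  have hfix (k : I) : R.form i (R.rho g⁻¹ (R.root k)) - R.form j (R.root k) = 0 := by
    rcases eq_or_ne k j with rfl | hkj
    · rw [hF, R.form_root, R.isGCM.diag, sub_self]
    rcases lt_trichotomy (R.form i (R.rho g⁻¹ (R.root k)) - R.form j (R.root k)) 0 with hlt | h0 | hgt
    · have := R.isNonneg_or_isNonneg_neg (s j * (g * s i * g⁻¹)) k
      rw [hT] at this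
      have h' := R.not_isNonneg_add_smul hkj hlt
      tauto
    · exact h0
    · have := R.isNonneg_or_isNonneg_neg (g * s i * g⁻¹ * s j) k
      rw [hT'] at this
      have h' := R.not_isNonneg_add_smul hkj (h := R.form j (R.root k) -
        R.form i (R.rho g⁻¹ (R.root k))) (by omega)
      tauto
  have h1 : s j * (g * s i * g⁻¹) = 1 := R.eq_one_of_isNonneg fun k => by
    rw [hT, hfix, zero_smul, add_zero]
    exact R.isNonneg_root k
  rw [eq_inv_of_mul_eq_one_right h1, inv_eq_of_mul_eq_one_left (R.mul_self j)]

end ReflectionRep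

theorem IsGeneralizedCartanMatrix.exists_of_mul_eq {I : Type*} {A : Matrix I I ℤ}
    (hA : IsGeneralizedCartanMatrix A) {i j : I} (hij : i ≠ j) {k : ℤ} (hk : 0 < k)
    (h : A i j * A j i = k) :
    ∃ a b : ℤ, 0 < a ∧ 0 < b ∧ a * b = k ∧ A i j = -a ∧ A j i = -b := by
  have h1 := hA.nonpos i j hij
  have h2 := hA.nonpos j i hij.symm
  have h1' : A i j ≠ 0 := fun h0 => by rw [h0] at h; omega
  have h2' : A j i ≠ 0 := fun h0 => by rw [h0] at h; omega
  exact ⟨-A i j, -A j i, by omega, by omega, by rw [neg_mul_neg, h], by simp, by simp⟩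

/-! ### The Weyl group acting on roots and coroots. -/

namespace KacMoodyRootDatum

variable {I : Type*} [Fintype I] {A : Matrix I I ℤ} {X Y : Type*}
  [AddCommGroup X] [Module.Free ℤ X] [Module.Finite ℤ X]
  [AddCommGroup Y] [Module.Free ℤ Y] [Module.Finite ℤ Y] (D : KacMoodyRootDatum A X Y)

theorem simpleReflection_apply (i : I) (x : X) :
    D.simpleReflection i x = x - D.pairing (D.simpleCoroot i) x • D.simpleRoot i :=
  Module.reflection_apply _ _

theorem simpleReflection_mul_self (i : I) : D.simpleReflection i * D.simpleReflection i = 1 := by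
  ext x
  exact Module.involutive_reflection (D.pairing_simple_self i) x

theorem pairing_injective : Function.Injective D.pairing := D.pairing.toPerfPair.injective

/-- The contragredient action as a homomorphism of groups. -/
noncomputable def contragredientHom : (X ≃ₗ[ℤ] X) →* (Y ≃ₗ[ℤ] Y) where
  toFun := D.contragredient
  map_one' := by
    ext y
    refine D.pairing_injective (LinearMap.ext fun x => ?_)
    rw [D.pairing_contragredient]
    rfl
  map_mul' u v := by
    ext y
    refine D.pairing_injective (LinearMap.ext fun x => ?_)
    rw [LinearEquiv.mul_apply, D.pairing_contragredient, D.pairing_contragredient,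
      D.pairing_contragredient]
    rfl

/-- The simple reflections as elements of the Weyl group. -/
def weylReflection (i : I) : D.weylGroup :=
  ⟨D.simpleReflection i, Subgroup.subset_closure ⟨i, rfl⟩⟩

theorem weylReflection_mul_self (i : I) : D.weylReflection i * D.weylReflection i = 1 :=
  Subtype.ext (D.simpleReflection_mul_self i)

theorem closure_weylReflection : Subgroup.closure (Set.range D.weylReflection) = ⊤ := by
  refine Subgroup.map_injective D.weylGroup.subtype_injective ?_
  rw [MonoidHom.map_closure, ← Set.range_comp, ← MonoidHom.range_eq_map, Subgroup.range_subtype]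
  rfl

theorem weylReflection_apply (i : I) (x : X) :
    (D.weylReflection i : X ≃ₗ[ℤ] X) x = x - D.pairing (D.simpleCoroot i) x • D.simpleRoot i :=
  D.simpleReflection_apply i x

theorem alternatingProd_two {i j : I} (h : A i j * A j i = 0) :
    alternatingProd D.weylReflection i j 2 = alternatingProd D.weylReflection j i 2 := by
  have h0 : A i j = 0 ∧ A j i = 0 := by
    rcases mul_eq_zero.1 h with h | h
    · exact ⟨h, D.isGCM.zero_symm _ _ h⟩
    · exact ⟨D.isGCM.zero_symm _ _ h, h⟩
  refine Subtype.ext (LinearEquiv.ext fun x => ?_)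
  simp [alternatingProd, weylReflection_apply, D.pairing_simple, h0, Nat.even_add_one]
  module

theorem alternatingProd_three {i j : I} (hij : i ≠ j) (h : A i j * A j i = 1) :
    alternatingProd D.weylReflection i j 3 = alternatingProd D.weylReflection j i 3 := by
  obtain ⟨a, b, ha, hb, hab, h1, h2⟩ := D.isGCM.exists_of_mul_eq hij (by norm_num) h
  have h0 : a = 1 ∧ b = 1 := by constructor <;> nlinarith
  obtain ⟨rfl, rfl⟩ := h0
  refine Subtype.ext (LinearEquiv.ext fun x => ?_)
  simp [alternatingProd, weylReflection_apply, D.pairing_simple, D.isGCM.diag, h1, h2,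
    Nat.even_add_one]
  module

theorem alternatingProd_four {i j : I} (hij : i ≠ j) (h : A i j * A j i = 2) :
    alternatingProd D.weylReflection i j 4 = alternatingProd D.weylReflection j i 4 := by
  obtain ⟨a, b, ha, hb, hab, h1, h2⟩ := D.isGCM.exists_of_mul_eq hij (by norm_num) h
  have ha2 : a ≤ 2 := by nlinarith
  refine Subtype.ext (LinearEquiv.ext fun x => ?_)
  interval_cases a
  · obtain rfl : b = 2 := by omega
    simp [alternatingProd, weylReflection_apply, D.pairing_simple, D.isGCM.diag, h1, h2,
      Nat.even_add_one]
    module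
  · obtain rfl : b = 1 := by omega
    simp [alternatingProd, weylReflection_apply, D.pairing_simple, D.isGCM.diag, h1, h2,
      Nat.even_add_one]
    module

theorem alternatingProd_six {i j : I} (hij : i ≠ j) (h : A i j * A j i = 3) :
    alternatingProd D.weylReflection i j 6 = alternatingProd D.weylReflection j i 6 := by
  obtain ⟨a, b, ha, hb, hab, h1, h2⟩ := D.isGCM.exists_of_mul_eq hij (by norm_num) h
  have ha2 : a ≤ 3 := by nlinarith
  refine Subtype.ext (LinearEquiv.ext fun x => ?_)
  interval_cases a
  · obtain rfl : b = 3 := by omega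
    simp [alternatingProd, weylReflection_apply, D.pairing_simple, D.isGCM.diag, h1, h2,
      Nat.even_add_one]
    module
  · omega
  · obtain rfl : b = 1 := by omega
    simp [alternatingProd, weylReflection_apply, D.pairing_simple, D.isGCM.diag, h1, h2,
      Nat.even_add_one]
    module

/-- The action of the Weyl group on `X`. -/
noncomputable def rootRep : ReflectionRep A D.weylReflection X where
  isGCM := D.isGCM
  mul_self := D.weylReflection_mul_self
  closure_eq := D.closure_weylReflection
  braid_two _ _ _ h := D.alternatingProd_two h
  braid_three _ _ := D.alternatingProd_three
  braid_four _ _ := D.alternatingProd_four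
  braid_six _ _ := D.alternatingProd_six
  rho := D.weylGroup.subtype
  root := D.simpleRoot
  form i := D.pairing (D.simpleCoroot i)
  form_root := D.pairing_simple
  rho_apply := D.weylReflection_apply
  linearIndependent := D.linearIndependent_simpleRoot

/-- The contragredient action of the Weyl group on `Y`. -/
noncomputable def corootRep : ReflectionRep A.transpose D.weylReflection Y where
  isGCM := ⟨D.isGCM.diag, fun i j h => D.isGCM.nonpos j i h.symm, fun i j => D.isGCM.zero_symm j i⟩
  mul_self := D.weylReflection_mul_self
  closure_eq := D.closure_weylReflection
  braid_two _ _ _ h' := D.alternatingProd_two (by rwa [mul_comm] at h')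
  braid_three _ _ h h' := D.alternatingProd_three h (by rwa [mul_comm] at h')
  braid_four _ _ h h' := D.alternatingProd_four h (by rwa [mul_comm] at h')
  braid_six _ _ h h' := D.alternatingProd_six h (by rwa [mul_comm] at h')
  rho := D.contragredientHom.comp D.weylGroup.subtype
  root := D.simpleCoroot
  form i := D.pairing.flip (D.simpleRoot i)
  form_root i j := D.pairing_simple j i
  rho_apply := D.contragredient_simpleReflection
  linearIndependent := D.linearIndependent_simpleCoroot

/-- The image of the `i`-th simple root under `g`. -/
noncomputable abbrev rootOf (g : D.weylGroup) (i : I) : X := D.rootRep.rho g (D.simpleRoot i)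

/-- The image of the `i`-th simple coroot under `g`. -/
noncomputable abbrev corootOf (g : D.weylGroup) (i : I) : Y :=
  D.corootRep.rho g (D.simpleCoroot i)

theorem pairing_rho (g : D.weylGroup) (y : Y) (x : X) :
    D.pairing (D.corootRep.rho g y) x = D.pairing y (D.rootRep.rho g⁻¹ x) :=
  D.pairing_contragredient _ _ _

theorem pairing_corootOf_rootOf (g : D.weylGroup) (i : I) :
    D.pairing (D.corootOf g i) (D.rootOf g i) = 2 := by
  rw [pairing_rho]
  exact D.rootRep.form_inv_apply_self g i

theorem conj_apply (g : D.weylGroup) (i : I) (x : X) :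
    D.rootRep.rho (g * D.weylReflection i * g⁻¹) x
      = x - D.pairing (D.corootOf g i) x • D.rootOf g i := by
  rw [pairing_rho]
  exact D.rootRep.rho_conj_apply g i x

/-- The two reflections coincide and have the same nonzero root, so their linear forms agree. -/
theorem corootOf_eq_of_rootOf_eq {g : D.weylGroup} {i j : I}
    (h : D.rootOf g i = D.simpleRoot j) : D.corootOf g i = D.simpleCoroot j := by
  have hc := D.rootRep.conj_eq_of_rho_root_eq h
  refine D.pairing_injective (LinearMap.ext fun x => ?_)
  have h1 := D.conj_apply g i x
  rw [hc, h] at h1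
  have h2 : D.rootRep.rho (D.weylReflection j) x
    = x - D.pairing (D.simpleCoroot j) x • D.simpleRoot j := D.rootRep.rho_apply j x
  rw [h2, sub_right_inj] at h1
  exact (smul_left_injective ℤ (D.rootRep.root_ne_zero j) h1).symm

/-- Equality of the reflections now comes from the coroot side; evaluating them at α_j, where the
coroot takes the value 2, recovers the root. This makes a root depend only on its coroot. -/
theorem rootOf_eq_of_corootOf_eq {g : D.weylGroup} {i j : I}
    (h : D.corootOf g i = D.simpleCoroot j) : D.rootOf g i = D.simpleRoot j := by
  have hc := D.corootRep.conj_eq_of_rho_root_eq h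
  have h1 := D.conj_apply g i (D.simpleRoot j)
  have h2 : D.rootRep.rho (D.weylReflection j) (D.simpleRoot j)
    = D.simpleRoot j - D.pairing (D.simpleCoroot j) (D.simpleRoot j) • D.simpleRoot j :=
    D.rootRep.rho_apply j _
  rw [hc, h, h2, sub_right_inj, D.pairing_simple_self] at h1
  exact (smul_right_injective X (two_ne_zero (α := ℤ)) h1).symm

theorem mem_realRoots {x : X} : x ∈ D.realRoots ↔ ∃ g i, D.rootOf g i = x :=
  ⟨fun ⟨w, hw, i, h⟩ => ⟨⟨w, hw⟩, i, h⟩, fun ⟨g, i, h⟩ => ⟨g, g.2, i, h⟩⟩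

theorem rho_mem_realRoots (g : D.weylGroup) {x : X} (hx : x ∈ D.realRoots) :
    D.rootRep.rho g x ∈ D.realRoots := by
  obtain ⟨g', i, rfl⟩ := D.mem_realRoots.1 hx
  exact D.mem_realRoots.2 ⟨g * g', i, by rw [rootOf, map_mul, LinearEquiv.mul_apply]⟩

theorem neg_mem_realRoots {x : X} (hx : x ∈ D.realRoots) : -x ∈ D.realRoots := by
  obtain ⟨g, i, rfl⟩ := D.mem_realRoots.1 hx
  refine D.mem_realRoots.2 ⟨g * D.weylReflection i, i, ?_⟩
  have := D.rootRep.rho_root_self i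
  rw [rootOf, map_mul, LinearEquiv.mul_apply, ← map_neg]
  exact congrArg _ this

theorem simpleRoot_mem_posRoots (i : I) : D.simpleRoot i ∈ D.posRoots :=
  ⟨D.mem_realRoots.2 ⟨1, i, by simp [rootOf]⟩, D.rootRep.isNonneg_root i⟩

theorem posRoots_or_negRoots {x : X} (hx : x ∈ D.realRoots) : x ∈ D.posRoots ∨ x ∈ D.negRoots := by
  obtain ⟨g, i, rfl⟩ := D.mem_realRoots.1 hx
  exact (D.rootRep.isNonneg_or_isNonneg_neg g i).imp (fun h => ⟨hx, h⟩)
    fun h => ⟨D.neg_mem_realRoots hx, h⟩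

theorem ne_zero_of_mem_realRoots {x : X} (hx : x ∈ D.realRoots) : x ≠ 0 := by
  obtain ⟨g, i, rfl⟩ := D.mem_realRoots.1 hx
  exact D.rootRep.rho_root_ne_zero g i

theorem not_mem_negRoots {x : X} (hx : x ∈ D.posRoots) : x ∉ D.negRoots := fun h =>
  D.ne_zero_of_mem_realRoots hx.1 (ReflectionRep.IsNonneg.eq_zero (R := D.rootRep) hx.2 h.2)

/-- The only positive real root proportional to a simple root is this simple root. -/
theorem eq_simpleRoot_of_eq_smul {x : X} (hx : x ∈ D.realRoots) {i : I} {n : ℕ}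
    (h : x = n • D.simpleRoot i) : x = D.simpleRoot i := by
  obtain ⟨g, j, rfl⟩ := D.mem_realRoots.1 hx
  -- α_j is n times a vector with integral coordinates, so n divides its j-th coordinate, which is
  -- 1.
  have h1 : D.simpleRoot j = n • D.rootOf g⁻¹ i := by
    have := congrArg (D.rootRep.rho g⁻¹) h
    rw [map_nsmul, rootOf, ← LinearEquiv.mul_apply, ← map_mul, inv_mul_cancel, map_one] at this
    exact this
  classical
  have h2 : ∃ c : I → ℤ, D.rootOf g⁻¹ i = ∑ k, c k • D.simpleRoot k := by
    rcases D.rootRep.isNonneg_or_isNonneg_neg g⁻¹ i with ⟨c, hc⟩ | ⟨c, hc⟩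
    · exact ⟨fun k => c k, by rw [rootOf]; exact hc.trans (by simp; rfl)⟩
    · exact ⟨fun k => -c k, by rw [rootOf]; exact (neg_eq_iff_eq_neg.1 hc).trans (by simp; rfl)⟩
  obtain ⟨c, hc⟩ := h2
  have h3 := D.rootRep.eq_of_sum_eq (c := Pi.single j 1) (d := fun k => n * c k) (by
    refine Eq.trans (b := D.simpleRoot j) (by simp [Pi.single_apply, ite_smul]; rfl) ?_
    rw [h1, hc, Finset.smul_sum]
    exact Finset.sum_congr rfl fun k _ => by rw [mul_smul, natCast_zsmul]; rfl) j
  rw [Pi.single_eq_same] at h3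
  have : (n : ℤ) ∣ 1 := ⟨c j, h3⟩
  have : n = 1 := by
    have := Int.natAbs_dvd_natAbs.2 this
    simpa using this
  rw [h, this, one_smul]

/-- Subtracting a multiple of a simple root `α i` from a positive real root other than `α i` does
not make it negative. -/
theorem not_isNonneg_smul_sub {x : X} (hx : x ∈ D.posRoots) {i : I} (hxi : x ≠ D.simpleRoot i)
    {k : ℕ} (hk : 0 < k) (l : ℤ) : ¬ D.rootRep.IsNonneg (l • D.simpleRoot i - k • x) := by
  classical
  rintro ⟨d, hd⟩
  obtain ⟨c, hc⟩ := hx.2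
  -- Away from i the coordinates are those of x times -k, so nonnegativity makes them vanish.
  have hz : ∀ j, j ≠ i → c j = 0 := by
    intro j hj
    have := D.rootRep.eq_of_sum_eq (c := fun j => (if j = i then l else 0) - k * c j)
      (d := fun j => d j) (by
        simp only [natCast_zsmul]
        rw [← hd, hc, Finset.smul_sum]
        simp only [sub_smul, Finset.sum_sub_distrib, ite_smul, zero_smul, Finset.sum_ite_eq',
          Finset.mem_univ, if_true, mul_smul, natCast_zsmul]
        rfl) j
    simp only [if_neg hj] at this
    have h0 : (k : ℤ) * c j = 0 := le_antisymm (by omega) (by positivity)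
    simpa [hk.ne'] using h0
  refine hxi (D.eq_simpleRoot_of_eq_smul hx.1 (n := c i) ?_)
  rw [hc, Finset.sum_eq_single i (fun j _ hj => by rw [hz j hj, zero_smul]) (by simp)]

theorem weylReflection_mem_posRoots {x : X} (hx : x ∈ D.posRoots) {i : I}
    (hxi : x ≠ D.simpleRoot i) : D.rootRep.rho (D.weylReflection i) x ∈ D.posRoots := by
  refine (D.posRoots_or_negRoots (D.rho_mem_realRoots _ hx.1)).resolve_right fun h => ?_
  have h2 : D.rootRep.rho (D.weylReflection i) x
    = x - D.pairing (D.simpleCoroot i) x • D.simpleRoot i := D.rootRep.rho_apply i x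
  refine D.not_isNonneg_smul_sub hx hxi one_pos (D.pairing (D.simpleCoroot i) x) ?_
  have h3 := h.2
  change D.rootRep.IsNonneg (-(D.rootRep.rho (D.weylReflection i) x)) at h3
  rw [h2, neg_sub] at h3
  rwa [one_smul]

/-! ### Descent on quantum roots. -/

/-- A pair `(g, j)` such that the root `g (α j)` is quantum, the coroot and the reflection being
computed with this pair. -/
def IsQuantumPair (g : D.weylGroup) (j : I) : Prop :=
  D.rootOf g j ∈ D.posRoots ∧ ∀ γ ∈ D.posRoots,
    D.rootRep.rho (g * D.weylReflection j * g⁻¹) γ ∈ D.negRoots → γ ≠ D.rootOf g j →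
      D.pairing (D.corootOf g j) γ = 1

variable {D}

theorem IsQuantum.isQuantumPair {β : X} (h : D.IsQuantum β) {g : D.weylGroup} {j : I}
    (hg : D.rootOf g j = β) : D.IsQuantumPair g j := by
  subst hg
  exact ⟨h.1, fun γ hγ hγ' hne => h.2 g g.2 j rfl γ ⟨hγ, hγ'⟩ hne⟩

/-- A quantum root that is not simple is obtained from another one by a simple reflection. -/
theorem IsQuantumPair.exists_reflection {g : D.weylGroup} {j : I} (h : D.IsQuantumPair g j)
    (hns : ∀ i, D.rootOf g j ≠ D.simpleRoot i) :
    ∃ i, D.pairing (D.corootOf g j) (D.simpleRoot i) = 1 ∧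
      D.IsQuantumPair (D.weylReflection i * g) j := by
  obtain ⟨hpos, hq⟩ := h
  obtain ⟨i, hi⟩ : ∃ i, 0 < D.pairing (D.corootOf g j) (D.simpleRoot i) := by
    by_contra! hle
    obtain ⟨c, hc⟩ := hpos.2
    have h2 := D.pairing_corootOf_rootOf g j
    rw [hc, map_sum] at h2
    have : ∑ i, D.pairing (D.corootOf g j) (c i • D.rootRep.root i) ≤ 0 :=
      Finset.sum_nonpos fun i _ => by
        rw [map_nsmul]
        exact nsmul_nonpos (hle i) _
    exact absurd (h2.symm.le.trans this) (by norm_num)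
  -- With k > 0 the value of the pairing, the image is α_i - kβ, which cannot be nonnegative because
  -- β ≠ α_i.
  have hinv : D.rootRep.rho (g * D.weylReflection j * g⁻¹) (D.simpleRoot i) ∈ D.negRoots := by
    refine (D.posRoots_or_negRoots
      (D.rho_mem_realRoots _ (D.simpleRoot_mem_posRoots i).1)).resolve_left fun hp => ?_
    have h3 := hp.2
    change D.rootRep.IsNonneg (D.rootRep.rho _ (D.simpleRoot i)) at h3
    rw [D.conj_apply] at h3
    lift D.pairing (D.corootOf g j) (D.simpleRoot i) to ℕ using hi.le with k
    refine D.not_isNonneg_smul_sub hpos (hns i) (k := k) (by exact_mod_cast hi) 1 ?_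
    rwa [one_smul, ← natCast_zsmul]
  have h1 := hq _ (D.simpleRoot_mem_posRoots i) hinv (hns i).symm
  refine ⟨i, h1, ?_⟩
  have hroot : D.rootOf (D.weylReflection i * g) j
      = D.rootRep.rho (D.weylReflection i) (D.rootOf g j) := by
    rw [rootOf, map_mul, LinearEquiv.mul_apply]
  have hpos' : D.rootOf (D.weylReflection i * g) j ∈ D.posRoots := by
    rw [hroot]
    exact D.weylReflection_mem_posRoots hpos (hns i)
  have hss (x : X) : D.rootRep.rho (D.weylReflection i) (D.rootRep.rho (D.weylReflection i) x) = x := by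
    rw [← LinearEquiv.mul_apply, ← map_mul, D.weylReflection_mul_self, map_one]
    rfl
  have hinv' : (D.weylReflection i)⁻¹ = D.weylReflection i :=
    inv_eq_of_mul_eq_one_left (D.weylReflection_mul_self i)
  have hpair (γ : X) : D.pairing (D.corootOf (D.weylReflection i * g) j) γ
      = D.pairing (D.corootOf g j) (D.rootRep.rho (D.weylReflection i) γ) := by
    rw [corootOf, map_mul, LinearEquiv.mul_apply, D.pairing_rho, hinv']
  have hneg : D.rootRep.rho (D.weylReflection i) (D.simpleRoot i) = -D.simpleRoot i :=
    D.rootRep.rho_root_self i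
  have hmi : D.pairing (D.corootOf (D.weylReflection i * g) j) (D.simpleRoot i) = -1 := by
    rw [hpair, hneg, map_neg, h1]
  set t := D.weylReflection i * g * D.weylReflection j * (D.weylReflection i * g)⁻¹ with ht
  have hti : D.rootRep.rho t (D.simpleRoot i)
      = D.simpleRoot i + D.rootOf (D.weylReflection i * g) j := by
    rw [ht, D.conj_apply, hmi]
    module
  have hcone : D.rootRep.IsNonneg (D.rootRep.rho t (D.simpleRoot i)) := by
    rw [hti]
    exact (D.rootRep.isNonneg_root i).add hpos'.2
  have htpos : D.rootRep.rho t (D.simpleRoot i) ∈ D.posRoots :=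
    ⟨D.rho_mem_realRoots _ (D.simpleRoot_mem_posRoots i).1, hcone⟩
  have htt : t * t = 1 := by
    rw [ht]
    have := D.weylReflection_mul_self j
    calc _ = D.weylReflection i * g * (D.weylReflection j * D.weylReflection j)
          * (D.weylReflection i * g)⁻¹ := by group
      _ = 1 := by rw [this]; group
  -- For an inversion γ of t, neither γ nor -tγ is α_i, since t sends α_i to a positive root. So r_i
  -- keeps both positive, and r_i γ is an inversion of s_β = r_i t r_i.
  refine ⟨hpos', fun γ hγ hγ' hne => ?_⟩
  have hγi : γ ≠ D.simpleRoot i := by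
    rintro rfl
    exact D.not_mem_negRoots htpos hγ'
  have hδ : -D.rootRep.rho t γ ∈ D.posRoots := hγ'
  have hδi : -D.rootRep.rho t γ ≠ D.simpleRoot i := by
    intro h
    have : D.rootRep.rho t (D.simpleRoot i) = -γ := by
      rw [← h, map_neg, ← LinearEquiv.mul_apply, ← map_mul, htt, map_one]
      rfl
    rw [this] at htpos
    exact D.not_mem_negRoots hγ htpos
  rw [hpair]
  refine hq _ (D.weylReflection_mem_posRoots hγ hγi) ?_ fun h => hne ?_
  · have := D.weylReflection_mem_posRoots hδ hδi
    rw [map_neg] at this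
    have e : g * D.weylReflection j * g⁻¹ * D.weylReflection i = D.weylReflection i * t := by
      rw [ht, mul_inv_rev, hinv']
      simp only [← mul_assoc, D.weylReflection_mul_self, one_mul]
    change -_ ∈ D.posRoots
    rwa [← LinearEquiv.mul_apply, ← map_mul, e, map_mul, LinearEquiv.mul_apply]
  · rw [hroot, ← h, hss]

variable (D)

/-- The same word length decides the sign in both representations. -/
theorem isNonneg_corootOf {g : D.weylGroup} {j : I} (h : D.rootOf g j ∈ D.posRoots) :
    D.corootRep.IsNonneg (D.corootOf g j) :=
  D.corootRep.isNonneg_rho_root g j (D.rootRep.wordLength_le_of_isNonneg h.2)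

variable (A) in
/-- The absolute values of the off-diagonal coefficients of a matrix. -/
def offDiagWeight [DecidableEq I] (i j : I) : ℕ := if i = j then 0 else (A i j).natAbs

theorem pairing_sum_simpleCoroot [DecidableEq I] (c : I → ℕ) (j : I) :
    D.pairing (∑ i, c i • D.simpleCoroot i) (D.simpleRoot j)
      = 2 * c j - (∑ i, c i * offDiagWeight A i j : ℕ) := by
  have (i : I) : D.pairing (c i • D.simpleCoroot i) (D.simpleRoot j)
      = (if i = j then 2 * (c i : ℤ) else 0) - (c i * offDiagWeight A i j : ℕ) := by
    rw [map_nsmul, LinearMap.smul_apply, D.pairing_simple, offDiagWeight]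
    split_ifs with h
    · rw [h, D.isGCM.diag]
      simp [mul_comm]
    · have := D.isGCM.nonpos i j h
      push_cast
      rw [abs_of_nonpos this]
      simp
  rw [map_sum, LinearMap.sum_apply, Finset.sum_congr rfl fun i _ => this i]
  simp [Finset.sum_sub_distrib]

variable {D}

/-- The coordinates of the coroot of a quantum root are obtained by the growth process. -/
theorem IsQuantumPair.growth [DecidableEq I] {g : D.weylGroup} {j : I} (h : D.IsQuantumPair g j)
    {c : I → ℕ} (hc : D.corootOf g j = ∑ i, c i • D.simpleCoroot i) :
    Growth (offDiagWeight A) c := by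
  -- The height of the coroot drops by 1 under `exists_reflection`.
  induction hN : ∑ i, c i generalizing g c with
  | zero =>
    exfalso
    refine D.corootRep.rho_root_ne_zero g j ?_
    change D.corootOf g j = 0
    rw [hc]
    refine Finset.sum_eq_zero fun i hi => ?_
    rw [Finset.sum_eq_zero_iff.1 hN i hi, zero_smul]
  | succ N ih =>
    by_cases hs : ∃ i, D.rootOf g j = D.simpleRoot i
    · obtain ⟨i, hi⟩ := hs
      rw [D.corootOf_eq_of_rootOf_eq hi] at hc
      have : c = Pi.single i 1 := by
        ext k
        have := D.corootRep.eq_of_sum_eq (c := fun k => (c k : ℤ))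
          (d := fun k => ((Pi.single i 1 : I → ℕ) k : ℤ)) (by
            simp only [natCast_zsmul]
            refine hc.symm.trans ?_
            simp [Pi.single_apply, ite_smul]
            rfl) k
        exact_mod_cast this
      rw [this]
      exact .single i
    · push Not at hs
      obtain ⟨i, hi, hq⟩ := h.exists_reflection hs
      obtain ⟨d, hd⟩ := D.isNonneg_corootOf hq.1
      have hd' : D.corootOf (D.weylReflection i * g) j = ∑ k, d k • D.simpleCoroot k := hd
      have e : D.corootOf (D.weylReflection i * g) j = D.corootOf g j - D.simpleCoroot i := by
        have h2 : D.corootRep.rho (D.weylReflection i) (D.corootOf g j) = D.corootOf g j -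
          D.pairing (D.corootOf g j) (D.simpleRoot i) • D.simpleCoroot i := D.corootRep.rho_apply i _
        rw [corootOf, map_mul, LinearEquiv.mul_apply, h2, hi, one_smul]
      have hcd : c = Function.update d i (d i + 1) := by
        ext k
        have := D.corootRep.eq_of_sum_eq (c := fun k => (c k : ℤ))
          (d := fun k => (d k : ℤ) + if k = i then 1 else 0) (by
            simp only [natCast_zsmul, add_smul, Finset.sum_add_distrib, ite_smul, zero_smul,
              one_smul, Finset.sum_ite_eq', Finset.mem_univ, if_true]
            refine hc.symm.trans ?_
            refine Eq.trans ?_ (congrArg (· + D.simpleCoroot i) hd')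
            simp only [e, sub_add_cancel]) k
        by_cases hk : k = i
        · subst hk
          rw [Function.update_self]
          simp only [if_true] at this
          omega
        · rw [Function.update_of_ne hk]
          simp only [if_neg hk] at this
          omega
      have hsum : ∑ k, c k = ∑ k, d k + 1 := by
        rw [hcd, Finset.sum_update_of_mem (Finset.mem_univ i),
          ← Finset.add_sum_erase _ d (Finset.mem_univ i), Finset.sdiff_singleton_eq_erase]
        omega
      rw [hcd]
      refine .step (ih hq hd' (by omega)) ?_
      -- The smaller coroot pairs with α_i to 1 - 2 = -1, which is the growth condition.
      have h3 := D.pairing_sum_simpleCoroot d i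
      rw [← hd', e, map_sub, LinearMap.sub_apply, hi, D.pairing_simple_self] at h3
      omega

variable (D)

/-! ### Counting by coordinates of coroots. -/

/-- The quantum roots are finite in number, and bounded in terms of the coordinates of the
coroots. -/
theorem finite_quantumRoots_and_ncard_le :
    D.quantumRoots.Finite ∧
      D.quantumRoots.ncard ≤ (max 6 (Fintype.card I) + 1) ^ Fintype.card I := by
  classical
  have hex : ∀ β ∈ D.quantumRoots, ∃ c : I → ℕ, Growth (offDiagWeight A) c ∧ ∃ g j,
      D.rootOf g j = β ∧ D.corootOf g j = ∑ i, c i • D.simpleCoroot i := by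
    intro β hβ
    obtain ⟨g, j, hg⟩ := D.mem_realRoots.1 hβ.1.1
    have hq := IsQuantum.isQuantumPair hβ hg
    obtain ⟨c, hc⟩ := D.isNonneg_corootOf hq.1
    exact ⟨c, hq.growth hc, g, j, hg, hc⟩
  choose! c hgrowth hc using hex
  let T : Finset (I → ℕ) :=
    Fintype.piFinset fun _ => Finset.range (max 6 (Fintype.card I) + 1)
  have hmaps : Set.MapsTo c D.quantumRoots T := by
    intro β hβ
    simp only [T, Finset.mem_coe, Fintype.mem_piFinset, Finset.mem_range, Nat.lt_succ_iff]
    refine (hgrowth β hβ).le_max (by simp [offDiagWeight]) fun i j hij => ?_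
    rcases eq_or_ne i j with rfl | h
    · exact hij
    · rw [offDiagWeight, if_neg h, Int.natAbs_eq_zero] at hij
      rw [offDiagWeight, if_neg h.symm, Int.natAbs_eq_zero]
      exact D.isGCM.zero_symm _ _ hij
  have hinj : Set.InjOn c D.quantumRoots := by
    intro β hβ β' hβ' h
    obtain ⟨g, j, hroot, hcoroot⟩ := hc β hβ
    obtain ⟨g', j', hroot', hcoroot'⟩ := hc β' hβ'
    have h1 : D.corootOf g j = D.corootOf g' j' := by rw [hcoroot, hcoroot', h]
    -- Equal coroots make g'⁻¹g carry one simple coroot to another, hence also the corresponding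
    -- simple roots.
    have h2 : D.corootOf (g'⁻¹ * g) j = D.simpleCoroot j' := by
      rw [corootOf, map_mul, LinearEquiv.mul_apply]
      refine (congrArg _ h1).trans ?_
      rw [corootOf, ← LinearEquiv.mul_apply, ← map_mul,
        inv_mul_cancel, map_one]
      rfl
    have h3 := D.rootOf_eq_of_corootOf_eq h2
    rw [← hroot, ← hroot', rootOf, rootOf, ← h3, rootOf, ← LinearEquiv.mul_apply, ← map_mul,
      mul_inv_cancel_left]
  refine ⟨.of_injOn hmaps hinj T.finite_toSet, ?_⟩
  have := Set.ncard_le_ncard_of_injOn c hmaps hinj T.finite_toSet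
  rwa [Set.ncard_coe_finset, Fintype.card_piFinset, Finset.prod_const, Finset.card_range,
    Finset.card_univ] at this

end KacMoodyRootDatum

theorem mainTheorem1 {I : Type*} [Fintype I] (n : ℕ) (hn : 2 ≤ n) (hI : Fintype.card I = n)
    (A : Matrix I I ℤ) {X Y : Type*}
    [AddCommGroup X] [Module.Free ℤ X] [Module.Finite ℤ X]
    [AddCommGroup Y] [Module.Free ℤ Y] [Module.Finite ℤ Y]
    (D : KacMoodyRootDatum A X Y) :
    D.quantumRoots.Finite ∧ D.quantumRoots.ncard ≤ n ^ (n + 5) := by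
  obtain ⟨h1, h2⟩ := D.finite_quantumRoots_and_ncard_le
  rw [hI] at h2
  exact ⟨h1, h2.trans (pow_succ_max_six_le hn)⟩
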